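/- Let $k$ be a field and $n \ge 0$ an integer. A $\mathbb{Z}^n$-module $N$ is a functor from the poset $\mathbb{Z}^n$ (componentwise order) to $k$-vector spaces: vector spaces $N_b$ for $b \in \mathbb{Z}^n$ with compatible linear maps $N_b \to N_c$ for $b \preceq c$; homomorphisms are natural transformations, i.e. degree-preserving homomorphisms. The module $N$ is *finitely determined* if every $N_b$ is finite-dimensional and, for each $i = 1, \dots, n$, the structure map $N_b \to N_{b+e_i}$ is an isomorphism whenever $b_i$ lies outside some bounded interval. An *injective hull* of $N$ is an injective homomorphism $N \to E$ into an injective object $E$ of the category of $\mathbb{Z}^n$-modules; it is *minimal* if the number of indecomposable summands of $E$ is minimal among all injective hulls of $N$ (this number being $\infty$ if $E$ is not a finite direct sum of indecomposables). An *injective resolution* $E^\bullet$ of $N$ is an exact sequence $0 \to N \to E^0 \to E^1 \to \cdots$ with every $E^i$ injective. It is *finite* if $\bigoplus_i E^i$ is a direct sum of finitely many indecomposable modules. It is *minimal* if $N \to E^0$, $\operatorname{coker}(N \to E^0) \to E^1$ and $\operatorname{coker}(E^{i-1} \to E^i) \to E^{i+1}$ for all $i \ge 1$ are minimal injective hulls.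 It has length at most $\ell$ if $E^i = 0$ for all $i > \ell$. Then the following are equivalent for a $\mathbb{Z}^n$-module $N$. 1. $N$ is finitely determined. 2. $N$ admits a finite injective resolution. 3. $N$ admits a finite minimal injective resolution. Moreover, any two finite minimal injective resolutions of $N$ are isomorphic, as cochain complexes, by an isomorphism compatible with the augmentations from $N$; and any finite minimal injective resolution of $N$ has length at most $n$. -/

import Mathlib

open CategoryTheory CategoryTheory.Limits

universe u

/-- The poset `ℤⁿ` with the componentwise order. (A type synonym, so that its category structure is
the one coming from the partial order.) -/
def ZnDegree (n : ℕ) : Type := Fin n → ℤ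

instance (n : ℕ) : PartialOrder (ZnDegree n) := inferInstanceAs (PartialOrder (Fin n → ℤ))

/-- The degree `b + e_i`. -/
def ZnDegree.addUnit {n : ℕ} (b : ZnDegree n) (i : Fin n) : ZnDegree n :=
  fun j : Fin n => if j = i then b j + 1 else b j

theorem ZnDegree.le_addUnit {n : ℕ} (b : ZnDegree n) (i : Fin n) : b ≤ b.addUnit i := by
  intro j
  simp only [ZnDegree.addUnit]
  split_ifs <;> omega

/-- `ℤⁿ`-modules over `k`: families of `k`-vector spaces `N_b`, `b ∈ ℤⁿ`, with functorial linear
maps `N_b → N_c` for `b ≤ c`, i.e. functors from the poset `ℤⁿ` to `k`-vector spaces. Their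
homomorphisms are the natural transformations, i.e. the degree-preserving homomorphisms. -/
abbrev ZnModule (k : Type u) [Field k] (n : ℕ) : Type (u + 1) :=
  ZnDegree n ⥤ ModuleCat.{u} k

namespace ZnModule

variable {k : Type u} [Field k] {n : ℕ}

/-- Multiplication by the variable `x_i`, as the map `N_b → N_{b + e_i}`. -/
def mulX (N : ZnModule k n) (i : Fin n) (b : ZnDegree n) :
    N.obj b ⟶ N.obj (b.addUnit i) :=
  N.map (homOfLE (b.le_addUnit i))

/-- `N` is finitely determined: all components are finite dimensional, and for every `i` the map
`x_i : N_b → N_{b + e_i}` is an isomorphism whenever `b_i` lies outside some bounded interval. -/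
def FinitelyDetermined (N : ZnModule k n) : Prop :=
  (∀ b, Module.Finite k (N.obj b)) ∧
    ∀ i : Fin n, ∃ lo hi : ℤ, ∀ b : ZnDegree n, b i ∉ Set.Icc lo hi → IsIso (N.mulX i b)

/-- `E` is a direct sum of `m` indecomposable modules. -/
def IsSumOfIndecomposables (E : ZnModule k n) (m : ℕ) : Prop :=
  ∃ D : Fin m → ZnModule k n, (∀ j, Indecomposable (D j)) ∧ Nonempty (E ≅ ∐ D)

/-- `E` has finitely many indecomposable summands. -/
def HasFinitelyManySummands (E : ZnModule k n) : Prop :=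
  ∃ m : ℕ, E.IsSumOfIndecomposables m

/-- The number of indecomposable summands of `E`, which is `⊤` if `E` is not a finite direct sum
of indecomposable modules. It is applied to injective modules only, for which the number of
summands in a decomposition into indecomposables does not depend on the decomposition. -/
noncomputable def numSummands (E : ZnModule k n) : ℕ∞ :=
  ⨅ (m : ℕ) (_ : E.IsSumOfIndecomposables m), (m : ℕ∞)

/-- An injective hull of `N`: an injective homomorphism into an injective module
(no minimality is required). -/
def IsInjectiveHull {N E : ZnModule k n} (f : N ⟶ E) : Prop :=
  Mono f ∧ Injective E

/-- An injective hull of `N` is minimal if its number of indecomposable summands is minimal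
among all injective hulls of `N`. -/
def IsMinimalInjectiveHull {N E : ZnModule k n} (f : N ⟶ E) : Prop :=
  IsInjectiveHull f ∧
    ∀ (E' : ZnModule k n) (f' : N ⟶ E'), IsInjectiveHull f' → E.numSummands ≤ E'.numSummands

/-- An injective resolution is finite if the direct sum of all its terms has finitely many
indecomposable summands. -/
def IsFiniteResolution {N : ZnModule k n} (E : InjectiveResolution N) : Prop :=
  (∐ fun i : ℕ => E.cocomplex.X i : ZnModule k n).HasFinitelyManySummands

/-- The augmentation `N → E⁰` of an injective resolution. -/
def augmentation {N : ZnModule k n} (E : InjectiveResolution N) : N ⟶ E.cocomplex.X 0 :=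
  E.ι.f 0

/-- An injective resolution `0 → N → E⁰ → E¹ → ⋯` is minimal if `N → E⁰`, `coker (N → E⁰) → E¹`
and `coker (Eⁱ → Eⁱ⁺¹) → Eⁱ⁺²` for all `i ≥ 0` are minimal injective hulls. -/
structure IsMinimalResolution {N : ZnModule k n} (E : InjectiveResolution N) : Prop where
  augmentation_minimal : IsMinimalInjectiveHull (augmentation E)
  zero_minimal : IsMinimalInjectiveHull
    (cokernel.desc (augmentation E) (E.cocomplex.d 0 1) E.ι_f_zero_comp_complex_d)
  succ_minimal : ∀ i : ℕ, IsMinimalInjectiveHull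
    (cokernel.desc (E.cocomplex.d i (i + 1)) (E.cocomplex.d (i + 1) (i + 2))
      (E.cocomplex.d_comp_d i (i + 1) (i + 2)))

/-- A resolution has length at most `l` if its terms in all degrees `i > l` vanish
(this includes the zero resolution of the zero module). -/
def LengthAtMost {N : ZnModule k n} (E : InjectiveResolution N) (l : ℕ) : Prop :=
  ∀ i : ℕ, l < i → IsZero (E.cocomplex.X i)

end ZnModule

/-! The building blocks are the orthant modules: `k` in the degrees b with b_i ≤ a_i for i ∈ S, zero
elsewhere. They are injective, and their endomorphisms are scalars, hence they are indecomposable.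
Every nonzero element of a module has a multiple annihilated by exactly a monomial prime
(`exists_isCogenerator`); in an injective module such an element produces an embedded orthant, which
splits off. The exchange lemma `IndecSum.exists_of_biprod_iso` then counts summands down, so an
injective that is a finite sum of indecomposables is a finite sum of orthants, hence finitely
determined. Since N is the kernel of E⁰ → E¹, a finite injective resolution makes N finitely
determined.

Conversely, a finitely determined module is controlled by a finite box of degrees, so it embeds in
finitely many orthants (`FinitelyDetermined.exists_embedding`). A hull with the fewest summands
therefore exists, its cokernel is again finitely determined, and the construction iterates.

Minimality enters through essentiality: an element of E with no nonzero multiple in N would give an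
orthant summand that can be dropped from the hull (`IsMinimalInjectiveHull.isEssential`).
Essentiality makes a comparison map between two minimal resolutions an isomorphism, degree by
degree.

The length bound is a dual of Hilbert's syzygy theorem. Passing to a cosyzygy raises Koszul
acyclicity by one (`KoszulAcyclic.quotient`), and a finitely determined module acyclic to order n
has no proper finitely determined essential extension. So the cosyzygies vanish after the n-th; this
also makes the iterated construction finite. -/

namespace ZnModule

variable {k : Type u} [Field k] {n : ℕ}

/-! ### Elementwise description of modules and homomorphisms -/

/-- The structure map `N_b → N_c` for `b ≤ c`, as a linear map. -/
def tr (N : ZnModule k n) {b c : ZnDegree n} (h : b ≤ c) : N.obj b →ₗ[k] N.obj c :=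
  (N.map (homOfLE h)).hom

/-- The degree `b` component of a homomorphism, as a linear map. -/
def ev {N M : ZnModule k n} (f : N ⟶ M) (b : ZnDegree n) : N.obj b →ₗ[k] M.obj b :=
  (f.app b).hom

section Elements

variable {N M L : ZnModule k n} {b c d : ZnDegree n}

@[simp]
theorem tr_refl (h : b ≤ b) (v : N.obj b) : N.tr h v = v := by
  simp [tr]

@[simp]
theorem tr_tr (h : b ≤ c) (h' : c ≤ d) (v : N.obj b) :
    N.tr h' (N.tr h v) = N.tr (h.trans h') v := by
  have : homOfLE (h.trans h') = homOfLE h ≫ homOfLE h' := Subsingleton.elim _ _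
  rw [tr, tr, tr, this, N.map_comp]
  rfl

theorem ev_tr (f : N ⟶ M) (h : b ≤ c) (v : N.obj b) :
    ev f c (N.tr h v) = M.tr h (ev f b v) :=
  LinearMap.congr_fun (congrArg ModuleCat.Hom.hom (f.naturality (homOfLE h))) v

@[simp]
theorem ev_comp (f : N ⟶ M) (g : M ⟶ L) (v : N.obj b) :
    ev (f ≫ g) b v = ev g b (ev f b v) := rfl

@[simp]
theorem ev_id (v : N.obj b) : ev (𝟙 N) b v = v := rfl

@[simp]
theorem ev_zero (v : N.obj b) : ev (0 : N ⟶ M) b v = 0 := rfl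

theorem ev_add (f g : N ⟶ M) (v : N.obj b) : ev (f + g) b v = ev f b v + ev g b v := rfl

theorem hom_ext_ev {f g : N ⟶ M} (h : ∀ b v, ev f b v = ev g b v) : f = g := by
  ext b v
  exact h b v

theorem mono_iff_ev (f : N ⟶ M) : Mono f ↔ ∀ b, Function.Injective (ev f b) := by
  rw [NatTrans.mono_iff_mono_app]
  exact forall_congr' fun b => ModuleCat.mono_iff_injective _

theorem epi_iff_ev (f : N ⟶ M) : Epi f ↔ ∀ b, Function.Surjective (ev f b) := by
  rw [NatTrans.epi_iff_epi_app]
  exact forall_congr' fun b => ModuleCat.epi_iff_surjective _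

theorem isIso_iff_ev (f : N ⟶ M) : IsIso f ↔ ∀ b, Function.Bijective (ev f b) := by
  rw [NatTrans.isIso_iff_isIso_app]
  exact forall_congr' fun b => ConcreteCategory.isIso_iff_bijective _

theorem isIso_mulX_iff (N : ZnModule k n) (i : Fin n) (b : ZnDegree n) :
    IsIso (N.mulX i b) ↔ Function.Bijective (N.tr (b.le_addUnit i)) :=
  ConcreteCategory.isIso_iff_bijective _

theorem isZero_iff_forall (N : ZnModule k n) : IsZero N ↔ ∀ b (v : N.obj b), v = 0 := by
  rw [IsZero.iff_id_eq_zero]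
  constructor
  · intro h b v
    simpa using congrArg (fun f => ev f b v) h
  · intro h
    exact hom_ext_ev fun b v => by simp [h b v]

theorem exists_ne_zero_of_not_isZero (h : ¬ IsZero N) : ∃ b, ∃ v : N.obj b, v ≠ 0 := by
  rw [isZero_iff_forall] at h
  push Not at h
  exact h

theorem ev_exact {S : ShortComplex (ZnModule k n)} (hS : S.Exact) (b : ZnDegree n)
    (v : S.X₂.obj b) : ev S.g b v = 0 ↔ ∃ u, ev S.f b u = v := by
  have h := hS.map ((evaluation (ZnDegree n) (ModuleCat.{u} k)).obj b)
  rw [ShortComplex.moduleCat_exact_iff_range_eq_ker] at h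
  exact ((SetLike.ext_iff.mp h) v).symm

theorem ev_cokernel_π (f : N ⟶ M) (v : M.obj b) :
    ev (cokernel.π f) b v = 0 ↔ ∃ u, ev f b u = v :=
  ev_exact (ShortComplex.exact_cokernel f) b v

theorem ev_cokernel_π_surjective (f : N ⟶ M) (b : ZnDegree n) :
    Function.Surjective (ev (cokernel.π f) b) :=
  (epi_iff_ev _).mp inferInstance b

end Elements

/-! ### Extension of elements into injective modules -/

/-- The free module on one generator in degree `b`. -/
noncomputable def free (k : Type u) [Field k] {n : ℕ} (b : ZnDegree n) : ZnModule k n where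
  obj c := ModuleCat.of k (PLift (b ≤ c) →₀ k)
  map {c d} f := ModuleCat.ofHom
    (Finsupp.lmapDomain k k fun h : PLift (b ≤ c) => PLift.up (h.down.trans (leOfHom f)))
  map_id c := ModuleCat.hom_ext (Finsupp.lhom_ext fun _ _ => Finsupp.mapDomain_single)
  map_comp f g := ModuleCat.hom_ext (Finsupp.lhom_ext fun _ _ => by
    simp [Finsupp.lmapDomain_apply])

/-- A multiple of the generator of the free module, in a degree `c ≥ b`. -/
noncomputable def freeGen {b c : ZnDegree n} (h : b ≤ c) (r : k) : (free k b).obj c :=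
  (Finsupp.single (PLift.up h) r : PLift (b ≤ c) →₀ k)

/-- The homomorphism from the free module sending its generator to `v`. -/
noncomputable def freeHom {N : ZnModule k n} {b : ZnDegree n} (v : N.obj b) :
    free k b ⟶ N where
  app c := ModuleCat.ofHom
    (Finsupp.linearCombination k fun h : PLift (b ≤ c) => N.tr h.down v)
  naturality c d f := ModuleCat.hom_ext (Finsupp.lhom_ext fun x r => by
    have := tr_tr x.down (leOfHom f) v
    simp only [free, ModuleCat.hom_comp, ModuleCat.hom_ofHom, LinearMap.comp_apply,
      Finsupp.lmapDomain_apply, Finsupp.mapDomain_single, Finsupp.linearCombination_single,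
      map_smul, ← this]
    rfl)

theorem free_cases {b c : ZnDegree n} (x : (free k b).obj c) :
    x = 0 ∨ ∃ (h : b ≤ c) (r : k), x = freeGen h r := by
  by_cases h : b ≤ c
  · refine Or.inr ⟨h, (show PLift (b ≤ c) →₀ k from x) ⟨h⟩, Finsupp.ext fun y => ?_⟩
    obtain rfl : y = ⟨h⟩ := Subsingleton.elim _ _
    exact Finsupp.single_eq_same.symm
  · exact Or.inl (Finsupp.ext fun y : PLift (b ≤ c) => (h y.down).elim)

theorem ev_freeHom_freeGen {N : ZnModule k n} {b c : ZnDegree n} (v : N.obj b) (h : b ≤ c) (r : k) :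
    ev (freeHom v) c (freeGen h r) = r • N.tr h v :=
  Finsupp.linearCombination_single _ _ _

/-- If `v` is killed by everything that kills `w`, then there is a homomorphism `w ↦ v` into any
injective module. -/
theorem exists_hom_of_injective {M E : ZnModule k n} [Injective E] {b : ZnDegree n}
    (w : M.obj b) (v : E.obj b) (h : ∀ (c) (hc : b ≤ c), M.tr hc w = 0 → E.tr hc v = 0) :
    ∃ g : M ⟶ E, ev g b w = v := by
  -- By the hypothesis, `freeHom v` factors through the submodule of `M` generated by `w`;
  -- injectivity of `E` then extends it to `M`.
  have hk : kernel.ι (freeHom w) ≫ freeHom v = 0 := by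
    refine hom_ext_ev fun c x => ?_
    have hx : ev (freeHom w) c (ev (kernel.ι (freeHom w)) c x) = 0 := by
      rw [← ev_comp, kernel.condition, ev_zero]
    rw [ev_comp, ev_zero]
    rcases free_cases (ev (kernel.ι (freeHom w)) c x) with h0 | ⟨hc, r, h0⟩
    · rw [h0, map_zero]
    · rw [h0] at hx ⊢
      rw [ev_freeHom_freeGen] at hx ⊢
      rcases smul_eq_zero.mp hx with hr | hr
      · rw [hr, zero_smul]
      · rw [h c hc hr, smul_zero]
  let e : Abelian.coimage (freeHom w) ⟶ E := cokernel.desc _ _ hk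
  refine ⟨Injective.factorThru e (Abelian.factorThruCoimage (freeHom w)), ?_⟩
  have hg : freeHom w ≫ Injective.factorThru e (Abelian.factorThruCoimage (freeHom w)) =
      freeHom v := by
    calc _ = (Abelian.coimage.π (freeHom w) ≫ Abelian.factorThruCoimage (freeHom w)) ≫ _ := by
          rw [Abelian.coimage.fac]
      _ = freeHom v := by
          rw [Category.assoc, Injective.comp_factorThru]
          exact cokernel.π_desc _ _ _
  have h1 := ev_freeHom_freeGen w le_rfl (1 : k)
  have h2 := ev_freeHom_freeGen v le_rfl (1 : k)
  rw [one_smul, tr_refl] at h1 h2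
  rw [← h2, ← hg, ev_comp, h1]

/-! ### The indecomposable injectives -/

/-- The degrees `b` with `b i ≤ a i` for all `i ∈ S`. -/
def Below (S : Set (Fin n)) (a b : ZnDegree n) : Prop := ∀ i ∈ S, b i ≤ a i

theorem Below.mono {S : Set (Fin n)} {a b c : ZnDegree n} (h : Below S a c) (hbc : b ≤ c) :
    Below S a b := fun i hi => (hbc i).trans (h i hi)

/-- The module which is `k` in the degrees `b` with `b i ≤ a i` for all `i ∈ S`. -/
def orthant (k : Type u) [Field k] {n : ℕ} (S : Set (Fin n)) (a : ZnDegree n) : ZnModule k n where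
  obj b := ModuleCat.of k (PLift (Below S a b) → k)
  map {b c} f := ModuleCat.ofHom
    (LinearMap.funLeft k k fun h : PLift (Below S a c) => PLift.up (h.down.mono (leOfHom f)))

section Orthant

variable {S : Set (Fin n)} {a b c : ZnDegree n}

/-- The standard generator of the orthant module in degree `b`. -/
def orthantOne (S : Set (Fin n)) (a b : ZnDegree n) : (orthant k S a).obj b :=
  (fun _ => 1 : PLift (Below S a b) → k)

@[simp]
theorem tr_orthantOne (h : b ≤ c) :
    (orthant k S a).tr h (orthantOne S a b) = orthantOne S a c := rfl

theorem orthant_eq_zero (h : ¬ Below S a b) (v : (orthant k S a).obj b) : v = 0 :=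
  funext fun x : PLift (Below S a b) => (h x.down).elim

theorem orthantOne_ne_zero (h : Below S a b) : (orthantOne S a b : (orthant k S a).obj b) ≠ 0 :=
  fun h0 => one_ne_zero (congrFun h0 (PLift.up h))

theorem exists_smul_orthantOne (v : (orthant k S a).obj b) : ∃ r : k, v = r • orthantOne S a b := by
  by_cases h : Below S a b
  · refine ⟨(v : PLift (Below S a b) → k) ⟨h⟩, funext fun x : PLift (Below S a b) => ?_⟩
    exact (mul_one ((v : PLift (Below S a b) → k) x)).symm
  · exact ⟨0, orthant_eq_zero h _ |>.trans (orthant_eq_zero h _).symm⟩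

theorem tr_orthant_injective (h : b ≤ c) (hc : Below S a c) :
    Function.Injective ((orthant k S a).tr h) := by
  rw [injective_iff_map_eq_zero]
  intro v hv
  obtain ⟨r, rfl⟩ := exists_smul_orthantOne v
  rw [map_smul, tr_orthantOne] at hv
  rcases smul_eq_zero.mp hv with h0 | h0
  · rw [h0, zero_smul]
  · exact (orthantOne_ne_zero hc h0).elim

end Orthant

/-- The join of two degrees. -/
def _root_.ZnDegree.join (b c : ZnDegree n) : ZnDegree n := fun i => max (b i) (c i)

theorem _root_.ZnDegree.le_join_left (b c : ZnDegree n) : b ≤ b.join c := fun _ => le_max_left _ _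

theorem _root_.ZnDegree.le_join_right (b c : ZnDegree n) : c ≤ b.join c := fun _ => le_max_right _ _

theorem Below.join {S : Set (Fin n)} {a b c : ZnDegree n} (hb : Below S a b) (hc : Below S a c) :
    Below S a (b.join c) := fun i hi => max_le (hb i hi) (hc i hi)

theorem below_self (S : Set (Fin n)) (a : ZnDegree n) : Below S a a := fun _ _ => le_rfl

section OrthantInjective

variable (S : Set (Fin n)) (a : ZnDegree n)

instance : Nonempty {b // Below S a b} := ⟨⟨a, below_self S a⟩⟩

instance : IsDirectedOrder {b // Below S a b} :=
  ⟨fun b c => ⟨⟨b.1.join c.1, b.2.join c.2⟩, b.1.le_join_left c.1, b.1.le_join_right c.1⟩⟩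

/-- The restriction of a module to the degrees in an orthant. -/
def restrict (N : ZnModule k n) : {b // Below S a b} ⥤ ModuleCat.{u} k :=
  (Subtype.mono_coe (Below S a)).functor ⋙ N

/-- The cocone on the restriction given by a homomorphism to the orthant module. -/
def coconeOfHom {N : ZnModule k n} (f : N ⟶ orthant k S a) : Cocone (restrict S a N) where
  pt := ModuleCat.of k k
  ι :=
    { app := fun b => ModuleCat.ofHom
        ((LinearMap.proj (PLift.up b.2)).comp (ev f b.1) : N.obj b.1 →ₗ[k] k)
      naturality := fun b c h => by
        ext v
        exact congrFun (ev_tr f (leOfHom h) v) (PLift.up c.2) }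

/-- The homomorphism to the orthant module given by a cocone on the restriction. -/
noncomputable def homOfCocone {N : ZnModule k n} (s : colimit (restrict S a N) ⟶ ModuleCat.of k k) :
    N ⟶ orthant k S a where
  app b := ModuleCat.ofHom
    (LinearMap.pi fun h : PLift (Below S a b) => (colimit.ι (restrict S a N) ⟨b, h.down⟩ ≫ s).hom)
  naturality b c f := by
    ext v
    refine funext fun h : PLift (Below S a c) => ?_
    have hw := colimit.w (restrict S a N)
      (homOfLE (leOfHom f) : (⟨b, h.down.mono (leOfHom f)⟩ : {b // Below S a b}) ⟶ ⟨c, h.down⟩)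
    have := congrArg (fun g => (g ≫ s).hom v) hw
    exact this

instance injective_field : Injective (ModuleCat.of k k) where
  factors {X Y} g f _ := by
    obtain ⟨l, hl⟩ := LinearMap.exists_leftInverse_of_injective f.hom
      (LinearMap.ker_eq_bot.mpr ((ModuleCat.mono_iff_injective f).mp inferInstance))
    refine ⟨ModuleCat.ofHom (g.hom.comp l), ?_⟩
    ext x
    have : l (f.hom x) = x := LinearMap.congr_fun hl x
    simp [this]

/-- Homomorphisms to the orthant module are linear forms on the colimit over the degrees of the
orthant. This poset is directed, so the colimit preserves monomorphisms, and linear forms extend. -/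
instance injective_orthant : Injective (orthant k S a) where
  factors {X Y} g f _ := by
    let α : restrict S a X ⟶ restrict S a Y :=
      Functor.whiskerLeft (Subtype.mono_coe (Below S a)).functor f
    have hf := (NatTrans.mono_iff_mono_app f).mp inferInstance
    have hα : ∀ b, Mono (α.app b) := fun b => hf b.1
    have : Mono α := NatTrans.mono_of_mono_app α
    have : AB5OfSize.{0, 0} (ModuleCat.{u} k) := AB5OfSize_of_univLE.{0, 0, u, u} _
    have : HasExactColimitsOfShape {b // Below S a b} (ModuleCat.{u} k) :=
      AB5OfSize.ofShape _
    have : Mono (colim.map α) := inferInstance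
    let s : colimit (restrict S a X) ⟶ ModuleCat.of k k := colimit.desc _ (coconeOfHom S a g)
    refine ⟨homOfCocone S a (Injective.factorThru s (colim.map α)), ?_⟩
    ext b v
    refine funext fun h : PLift (Below S a b) => ?_
    have h1 : colimit.ι (restrict S a X) ⟨b, h.down⟩ ≫ colim.map α =
        α.app ⟨b, h.down⟩ ≫ colimit.ι (restrict S a Y) ⟨b, h.down⟩ := ι_colimMap _ _
    have h2 : colim.map α ≫ Injective.factorThru s (colim.map α) = s :=
      Injective.comp_factorThru _ _
    have h3 : colimit.ι (restrict S a X) ⟨b, h.down⟩ ≫ s = (coconeOfHom S a g).ι.app ⟨b, h.down⟩ :=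
      colimit.ι_desc _ _
    have h4 := h1 =≫ Injective.factorThru s (colim.map α)
    rw [Category.assoc, Category.assoc, h2] at h4
    exact congrArg (fun t => t.hom v) (h4.symm.trans h3)

end OrthantInjective

/-! ### Endomorphisms of the orthant modules -/

/-- The identity is not a sum of two endomorphisms neither of which is an isomorphism. -/
def LocalEnd (I : ZnModule k n) : Prop :=
  ∀ f g : I ⟶ I, f + g = 𝟙 I → IsIso f ∨ IsIso g

theorem orthant_not_isZero (S : Set (Fin n)) (a : ZnDegree n) : ¬ IsZero (orthant k S a) := by
  rw [isZero_iff_forall]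
  intro h
  exact orthantOne_ne_zero (below_self S a) (h a _)

/-- Any endomorphism is a scalar: in degree b it is compared with its value in degree a inside
degree `a.join b`, where the structure maps from both are injective. -/
theorem isIso_orthant_of_ne_zero {S : Set (Fin n)} {a : ZnDegree n}
    (f : orthant k S a ⟶ orthant k S a) (hf : ev f a (orthantOne S a a) ≠ 0) : IsIso f := by
  obtain ⟨r, hr⟩ := exists_smul_orthantOne (ev f a (orthantOne S a a))
  have hr0 : r ≠ 0 := by
    rintro rfl
    exact hf (by rw [hr, zero_smul])
  have key : ∀ b (v : (orthant k S a).obj b), ev f b v = r • v := by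
    intro b v
    by_cases hb : Below S a b
    · obtain ⟨s, rfl⟩ := exists_smul_orthantOne v
      rw [map_smul, smul_comm r s]
      congr 1
      apply tr_orthant_injective (a.le_join_right b) ((below_self S a).join hb)
      have h1 := ev_tr f (a.le_join_left b) (orthantOne S a a)
      rw [hr, map_smul, tr_orthantOne] at h1
      rw [← ev_tr, map_smul, tr_orthantOne, h1]
    · exact (orthant_eq_zero hb _).trans (orthant_eq_zero hb _).symm
  rw [isIso_iff_ev]
  intro b
  constructor
  · intro v w h
    rw [key, key] at h
    exact smul_right_injective _ hr0 h
  · intro v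
    exact ⟨r⁻¹ • v, by rw [key, smul_smul, mul_inv_cancel₀ hr0, one_smul]⟩

theorem localEnd_orthant (S : Set (Fin n)) (a : ZnDegree n) : LocalEnd (orthant k S a) := by
  intro f g hfg
  by_contra! h
  have h1 : ev f a (orthantOne S a a) = 0 := by_contra fun h0 => h.1 (isIso_orthant_of_ne_zero f h0)
  have h2 : ev g a (orthantOne S a a) = 0 := by_contra fun h0 => h.2 (isIso_orthant_of_ne_zero g h0)
  have h3 := congrArg (fun t => ev t a (orthantOne S a a)) hfg
  simp only [ev_add, h1, h2, add_zero, ev_id] at h3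
  exact orthantOne_ne_zero (below_self S a) h3.symm

/-! ### Structure maps along paths of isomorphisms -/

theorem _root_.ZnDegree.le_apply {b c : ZnDegree n} (h : b ≤ c) (i : Fin n) : b i ≤ c i := h i

theorem _root_.ZnDegree.addUnit_le {b c : ZnDegree n} (h : b ≤ c) {i : Fin n} (hi : b i < c i) :
    b.addUnit i ≤ c := by
  intro j
  have := h j
  simp only [ZnDegree.addUnit]
  split_ifs with hj
  · subst hj
    omega
  · exact this

theorem _root_.ZnDegree.addUnit_self (b : ZnDegree n) (i : Fin n) : b.addUnit i i = b i + 1 :=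
  if_pos rfl

theorem _root_.ZnDegree.addUnit_of_ne (b : ZnDegree n) {i j : Fin n} (h : j ≠ i) :
    b.addUnit i j = b j := if_neg h

/-- The structure map factors along a lattice path of unit steps from b to c, each an isomorphism by
hypothesis. -/
theorem tr_bijective (N : ZnModule k n) {b c : ZnDegree n} (h : b ≤ c)
    (hN : ∀ i d, b ≤ d → d ≤ c → d i < c i → Function.Bijective (N.tr (d.le_addUnit i))) :
    Function.Bijective (N.tr h) := by
  obtain ⟨m, hm⟩ : ∃ m : ℕ, m = ∑ i, (c i - b i).toNat := ⟨_, rfl⟩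
  induction m using Nat.strong_induction_on generalizing b with
  | _ m ih =>
    by_cases hbc : b = c
    · subst hbc
      have : ⇑(N.tr h) = id := funext fun v => tr_refl h v
      rw [this]
      exact Function.bijective_id
    · obtain ⟨i, hi⟩ : ∃ i, b i < c i := by
        by_contra! h'
        exact hbc (funext fun i => le_antisymm (h i) (h' i))
      have h2 := ZnDegree.addUnit_le h hi
      have hlt : ∑ j, (c j - b.addUnit i j).toNat < m := by
        rw [hm]
        refine Finset.sum_lt_sum (fun j _ => ?_) ⟨i, Finset.mem_univ _, ?_⟩
        · have := ZnDegree.le_apply (b.le_addUnit i) j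
          omega
        · rw [b.addUnit_self]
          omega
      have h3 := ih _ hlt h2 (fun j d hd => hN j d ((b.le_addUnit i).trans hd)) rfl
      have h4 := hN i b le_rfl h hi
      have h5 : ⇑(N.tr h) = N.tr h2 ∘ N.tr (b.le_addUnit i) :=
        funext fun v => (tr_tr (b.le_addUnit i) h2 v).symm
      rw [h5]
      exact h3.comp h4

/-! ### Elements with prime annihilator -/

/-- The element `v` is killed by the variables in `S` and by no product of other variables. -/
structure IsCogenerator {N : ZnModule k n} {b : ZnDegree n} (v : N.obj b) (S : Set (Fin n)) :
    Prop where
  tr_eq_zero : ∀ i ∈ S, N.tr (b.le_addUnit i) v = 0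
  tr_ne_zero : ∀ (c) (h : b ≤ c), (∀ i ∈ S, c i = b i) → N.tr h v ≠ 0

theorem IsCogenerator.tr_eq_zero_of_lt {N : ZnModule k n} {b : ZnDegree n} {v : N.obj b}
    {S : Set (Fin n)} (hv : IsCogenerator v S) {c : ZnDegree n} (h : b ≤ c) {i : Fin n}
    (hi : i ∈ S) (hbc : b i < c i) : N.tr h v = 0 := by
  rw [← tr_tr (b.le_addUnit i) (ZnDegree.addUnit_le h hbc), hv.tr_eq_zero i hi, map_zero]

/-- Every nonzero element has a multiple with prime annihilator. -/
theorem exists_isCogenerator {N : ZnModule k n} {b₀ : ZnDegree n} (v₀ : N.obj b₀) (hv₀ : v₀ ≠ 0) :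
    ∃ (b : ZnDegree n) (h : b₀ ≤ b) (S : Set (Fin n)), IsCogenerator (N.tr h v₀) S := by
  classical
  -- Variables are treated one at a time: those in `S` already kill the multiple, while no product
  -- of variables from `U \ S` does.
  suffices H : ∀ U : Finset (Fin n), ∃ (b : ZnDegree n) (h : b₀ ≤ b) (S : Finset (Fin n)), S ⊆ U ∧
      (∀ i ∈ S, N.tr (h.trans (b.le_addUnit i)) v₀ = 0) ∧
      ∀ (c) (hc : b ≤ c), (∀ i, i ∉ U \ S → c i = b i) → N.tr (h.trans hc) v₀ ≠ 0 by
    obtain ⟨b, h, S, -, h1, h2⟩ := H Finset.univ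
    refine ⟨b, h, S, fun i hi => ?_, fun c hc hS => ?_⟩
    · rw [tr_tr]
      exact h1 i hi
    · rw [tr_tr]
      refine h2 c hc fun i hi => hS i ?_
      simpa using hi
  intro U
  induction U using Finset.induction_on with
  | empty =>
    refine ⟨b₀, le_rfl, ∅, subset_rfl, by simp, fun c hc h => ?_⟩
    obtain rfl : c = b₀ := funext fun i => h i (by simp)
    simpa using hv₀
  | insert i U hiU ih =>
    obtain ⟨b, h, S, hSU, h1, h2⟩ := ih
    have hiS : i ∉ S := fun hi => hiU (hSU hi)
    by_cases hex : ∃ m : ℕ, ∃ (c : ZnDegree n) (hc : b ≤ c), c i = b i + m ∧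
        (∀ j, j ∉ insert i U \ S → c j = b j) ∧ N.tr (h.trans hc) v₀ = 0
    · have hmin := fun m hm => Nat.find_min hex (m := m) hm
      obtain ⟨c, hc, hci, hcj, hc0⟩ := Nat.find_spec hex
      set m := Nat.find hex
      have hm : m ≠ 0 := by
        intro hm
        rw [hm] at hci
        refine h2 c hc (fun j hj => ?_) hc0
        by_cases hji : j = i
        · subst hji
          simpa using hci
        · exact hcj j (by simp_all)
      -- One step back from a vanishing multiple with the least exponent m of x_i: now x_i kills,
      -- and by minimality no product of variables in `U \ S` does.
      let b' : ZnDegree n := fun j => if j = i then c j - 1 else c j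
      have hb'i : b' i = c i - 1 := if_pos rfl
      have hb'j : ∀ j, j ≠ i → b' j = c j := fun j hj => if_neg hj
      have hbb' : b ≤ b' := by
        intro j
        have := ZnDegree.le_apply hc j
        by_cases hj : j = i
        · subst hj
          have h' : b j ≤ b' j := by omega
          exact h'
        · rwa [hb'j j hj]
      refine ⟨b', h.trans hbb', insert i S, Finset.insert_subset_insert _ hSU, ?_, ?_⟩
      · intro j hj
        rcases Finset.mem_insert.mp hj with rfl | hj
        · have : b'.addUnit j = c := by
            funext l
            by_cases hl : l = j
            · subst hl
              rw [ZnDegree.addUnit_self, hb'i]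
              exact sub_add_cancel _ _
            · rw [ZnDegree.addUnit_of_ne _ hl, hb'j l hl]
          have hle : c ≤ b'.addUnit j := this.ge
          rw [← tr_tr (h.trans hc) hle, hc0, map_zero]
        · have hle : b.addUnit j ≤ b'.addUnit j := by
            intro l
            have := ZnDegree.le_apply hbb' l
            simp only [ZnDegree.addUnit]
            split_ifs <;> omega
          rw [← tr_tr (h.trans (b.le_addUnit j)) hle, h1 j hj, map_zero]
      · intro d hd hdj h0
        refine hmin (m - 1) (by omega) ⟨d, hbb'.trans hd, ?_, ?_, h0⟩
        · rw [hdj i (by simp), hb'i]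
          omega
        · intro j hj
          by_cases hji : j = i
          · subst hji
            simp [hiS] at hj
          · rw [hdj j (by simp_all), hb'j j hji, hcj j hj]
    · refine ⟨b, h, S, hSU.trans (Finset.subset_insert _ _), h1, fun c hc hcj h0 => hex ?_⟩
      exact ⟨(c i - b i).toNat, c, hc, by have := ZnDegree.le_apply hc i; omega, hcj, h0⟩

/-- An element with prime annihilator in an injective module lies in a submodule isomorphic to an
orthant module. -/
theorem IsCogenerator.exists_hom {E : ZnModule k n} [Injective E] {b : ZnDegree n} {v : E.obj b}
    {S : Set (Fin n)} (hv : IsCogenerator v S) :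
    ∃ g : orthant k S b ⟶ E, ev g b (orthantOne S b b) = v ∧ Mono g := by
  obtain ⟨g, hg⟩ := exists_hom_of_injective (M := orthant k S b) (orthantOne S b b) v (by
    intro c hc h0
    rw [tr_orthantOne] at h0
    have : ¬ Below S b c := fun h => orthantOne_ne_zero h h0
    simp only [Below] at this
    push Not at this
    obtain ⟨i, hi, hlt⟩ := this
    exact hv.tr_eq_zero_of_lt hc hi hlt)
  refine ⟨g, hg, (mono_iff_ev g).mpr fun c => ?_⟩
  rw [injective_iff_map_eq_zero]
  intro x hx
  by_cases hc : Below S b c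
  · obtain ⟨r, rfl⟩ := exists_smul_orthantOne x
    -- Elements in degrees b and c are compared in the join, which agrees with b on `S`, so the
    -- multiple of `v` there is nonzero.
    have h1 := ev_tr g (b.le_join_left c) (orthantOne S b b)
    have h2 := ev_tr g (b.le_join_right c) (orthantOne S b c)
    rw [tr_orthantOne] at h1 h2
    rw [hg] at h1
    have h3 : r • E.tr (b.le_join_left c) v = 0 := by
      rw [← h1, h2, ← map_smul, ← map_smul, hx, map_zero]
    rcases smul_eq_zero.mp h3 with h0 | h0
    · rw [h0, zero_smul]
    · exact (hv.tr_ne_zero _ _ (fun i hi => max_eq_left (hc i hi)) h0).elim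
  · exact orthant_eq_zero hc x

/-- A nonzero injective module contains an orthant module. -/
theorem exists_orthant_mono {E : ZnModule k n} [Injective E] (h : ¬ IsZero E) :
    ∃ (S : Set (Fin n)) (a : ZnDegree n) (g : orthant k S a ⟶ E), Mono g := by
  obtain ⟨b₀, v₀, hv₀⟩ := exists_ne_zero_of_not_isZero h
  obtain ⟨b, hb, S, hv⟩ := exists_isCogenerator v₀ hv₀
  obtain ⟨g, -, hg⟩ := hv.exists_hom
  exact ⟨S, b, g, hg⟩

/-! ### Finitely determined modules -/

/-- The structure maps in direction `i` are isomorphisms outside the interval `[lo i, hi i]`. -/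
def HasBounds (N : ZnModule k n) (lo hi : ZnDegree n) : Prop :=
  ∀ (i : Fin n) (b : ZnDegree n), (b i < lo i ∨ hi i < b i) →
    Function.Bijective (N.tr (b.le_addUnit i))

/-- A unit step in direction i leaves the orthant only if i ∈ S and b_i = a_i, which lies in the
interval. -/
theorem hasBounds_orthant {S : Set (Fin n)} {a lo hi : ZnDegree n}
    (h : ∀ i ∈ S, lo i ≤ a i ∧ a i ≤ hi i) : (orthant k S a).HasBounds lo hi := by
  intro i b hb
  have hiff : Below S a b → Below S a (b.addUnit i) := by
    intro h' j hj
    have := h' j hj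
    by_cases hji : j = i
    · subst hji
      rw [ZnDegree.addUnit_self]
      have := h j hj
      omega
    · rwa [ZnDegree.addUnit_of_ne _ hji]
  by_cases h : Below S a b
  · refine ⟨tr_orthant_injective _ (hiff h), fun v => ?_⟩
    obtain ⟨r, rfl⟩ := exists_smul_orthantOne v
    exact ⟨r • orthantOne S a b, by rw [map_smul, tr_orthantOne]⟩
  · refine ⟨fun v w _ => (orthant_eq_zero h v).trans (orthant_eq_zero h w).symm, fun v => ?_⟩
    exact ⟨0, (orthant_eq_zero (fun h' => h (h'.mono (b.le_addUnit i))) _).trans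
      (orthant_eq_zero (fun h' => h (h'.mono (b.le_addUnit i))) _).symm⟩

theorem FinitelyDetermined.exists_bounds {N : ZnModule k n} (h : N.FinitelyDetermined) :
    ∃ lo hi, N.HasBounds lo hi := by
  choose lo hi H using h.2
  refine ⟨lo, hi, fun i b hb => (isIso_mulX_iff N i b).mp (H i b ?_)⟩
  simp only [Set.mem_Icc]
  omega

theorem FinitelyDetermined.of_bounds {N : ZnModule k n} (h : ∀ b, Module.Finite k (N.obj b))
    (lo hi : ZnDegree n) (hb : N.HasBounds lo hi) : N.FinitelyDetermined := by
  refine ⟨h, fun i => ⟨lo i, hi i, fun b hbi => (isIso_mulX_iff N i b).mpr (hb i b ?_)⟩⟩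
  simp only [Set.mem_Icc] at hbi
  omega

theorem orthant_finitelyDetermined (S : Set (Fin n)) (a : ZnDegree n) :
    (orthant k S a).FinitelyDetermined := by
  refine .of_bounds (fun b => ?_) a a (hasBounds_orthant fun i _ => ⟨le_rfl, le_rfl⟩)
  have : Finite (PLift (Below S a b)) := inferInstance
  exact inferInstanceAs (Module.Finite k (PLift (Below S a b) → k))

theorem FinitelyDetermined.exists_common_bounds {N M : ZnModule k n} (hN : N.FinitelyDetermined)
    (hM : M.FinitelyDetermined) : ∃ lo hi, N.HasBounds lo hi ∧ M.HasBounds lo hi := by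
  obtain ⟨lo, hi, h⟩ := hN.exists_bounds
  obtain ⟨lo', hi', h'⟩ := hM.exists_bounds
  refine ⟨fun i => min (lo i) (lo' i), fun i => max (hi i) (hi' i), fun i b hb => h i b ?_,
    fun i b hb => h' i b ?_⟩ <;> simp only at hb <;> omega

/-- The kernel of a homomorphism of finitely determined modules is finitely determined. -/
theorem FinitelyDetermined.of_left_exact {N A B : ZnModule k n} (f : N ⟶ A) (g : A ⟶ B)
    (hf : ∀ b, Function.Injective (ev f b))
    (hfg : ∀ b v, ev g b v = 0 ↔ ∃ u, ev f b u = v)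
    (hA : A.FinitelyDetermined) (hB : B.FinitelyDetermined) : N.FinitelyDetermined := by
  obtain ⟨lo, hi, h1, h2⟩ := hA.exists_common_bounds hB
  refine .of_bounds (fun b => ?_) lo hi fun i b hb => ⟨?_, fun v => ?_⟩
  · have := hA.1 b
    exact Module.Finite.of_injective (ev f b) (hf b)
  · intro v w hvw
    apply hf b
    apply (h1 i b hb).1
    rw [← ev_tr, hvw, ev_tr]
  · obtain ⟨u, hu⟩ := (h1 i b hb).2 (ev f _ v)
    have : ev g b u = 0 := by
      apply (h2 i b hb).1
      rw [← ev_tr, hu, map_zero]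
      exact (hfg _ _).mpr ⟨v, rfl⟩
    obtain ⟨w, rfl⟩ := (hfg _ _).mp this
    refine ⟨w, hf _ ?_⟩
    rw [ev_tr, hu]

/-- The cokernel of a homomorphism of finitely determined modules is finitely determined. -/
theorem FinitelyDetermined.of_right_exact {N A B : ZnModule k n} (f : N ⟶ A) (g : A ⟶ B)
    (hg : ∀ b, Function.Surjective (ev g b))
    (hfg : ∀ b v, ev g b v = 0 ↔ ∃ u, ev f b u = v)
    (hN : N.FinitelyDetermined) (hA : A.FinitelyDetermined) : B.FinitelyDetermined := by
  obtain ⟨lo, hi, h1, h2⟩ := hN.exists_common_bounds hA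
  refine .of_bounds (fun b => ?_) lo hi fun i b hb => ⟨?_, fun v => ?_⟩
  · have := hA.1 b
    exact Module.Finite.of_surjective (ev g b) (hg b)
  · rw [injective_iff_map_eq_zero]
    intro v hv
    obtain ⟨w, rfl⟩ := hg b v
    rw [← ev_tr, hfg] at hv
    obtain ⟨u, hu⟩ := hv
    obtain ⟨u', rfl⟩ := (h1 i b hb).2 u
    rw [ev_tr] at hu
    rw [hfg]
    exact ⟨u', (h2 i b hb).1 hu⟩
  · obtain ⟨w, rfl⟩ := hg _ v
    obtain ⟨w', rfl⟩ := (h2 i b hb).2 w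
    exact ⟨ev g b w', (ev_tr g _ w').symm⟩

theorem FinitelyDetermined.cokernel {N A : ZnModule k n} (f : N ⟶ A)
    (hN : N.FinitelyDetermined) (hA : A.FinitelyDetermined) :
    (cokernel f).FinitelyDetermined :=
  .of_right_exact f (cokernel.π f) (ev_cokernel_π_surjective f) (fun _ => ev_cokernel_π f) hN hA

theorem FinitelyDetermined.of_iso {N M : ZnModule k n} (e : N ≅ M) (h : M.FinitelyDetermined) :
    N.FinitelyDetermined := by
  refine .of_left_exact (N := N) (A := M) (B := M) e.hom 0
    (fun b => ((isIso_iff_ev e.hom).mp inferInstance b).1) (fun b v => ?_) h h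
  simp only [ev_zero, true_iff]
  exact ((isIso_iff_ev e.hom).mp inferInstance b).2 v

theorem hasBounds_of_isZero {N : ZnModule k n} (h : IsZero N) (lo hi : ZnDegree n) :
    N.HasBounds lo hi := fun _ b _ =>
  ⟨fun v w _ => ((isZero_iff_forall N).mp h b v).trans ((isZero_iff_forall N).mp h b w).symm,
    fun v => ⟨0, ((isZero_iff_forall N).mp h _ _).trans ((isZero_iff_forall N).mp h _ v).symm⟩⟩

theorem FinitelyDetermined.of_isZero {N : ZnModule k n} (h : IsZero N) : N.FinitelyDetermined := by
  have : ∀ b, Subsingleton (N.obj b) := fun b =>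
    ⟨fun v w => ((isZero_iff_forall N).mp h b v).trans ((isZero_iff_forall N).mp h b w).symm⟩
  exact .of_bounds (fun b => inferInstance) (fun _ => 0) (fun _ => 0) (hasBounds_of_isZero h _ _)

section Biprod

variable {N M : ZnModule k n} {b : ZnDegree n}

theorem biprod_total_ev (v : (N ⊞ M).obj b) :
    ev biprod.inl b (ev (biprod.fst : N ⊞ M ⟶ N) b v) +
      ev biprod.inr b (ev (biprod.snd : N ⊞ M ⟶ M) b v) = v := by
  rw [← ev_comp, ← ev_comp, ← ev_add, biprod.total, ev_id]

theorem HasBounds.biprod {lo hi : ZnDegree n} (hN : N.HasBounds lo hi) (hM : M.HasBounds lo hi) :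
    (N ⊞ M).HasBounds lo hi := by
  refine fun i b hb => ⟨fun v w hvw => ?_, fun v => ?_⟩
  · rw [← biprod_total_ev v, ← biprod_total_ev w]
    congr 2
    · apply (hN i b hb).1
      rw [← ev_tr, hvw, ev_tr]
    · apply (hM i b hb).1
      rw [← ev_tr, hvw, ev_tr]
  · obtain ⟨x, hx⟩ := (hN i b hb).2 (ev biprod.fst _ v)
    obtain ⟨y, hy⟩ := (hM i b hb).2 (ev biprod.snd _ v)
    exact ⟨ev biprod.inl b x + ev biprod.inr b y, by
      rw [map_add, ← ev_tr, ← ev_tr, hx, hy, biprod_total_ev]⟩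

theorem FinitelyDetermined.biprod (hN : N.FinitelyDetermined)
    (hM : M.FinitelyDetermined) : (N ⊞ M).FinitelyDetermined := by
  obtain ⟨lo, hi, h1, h2⟩ := hN.exists_common_bounds hM
  refine .of_bounds (fun b => ?_) lo hi (h1.biprod h2)
  have := hN.1 b
  have := hM.1 b
  refine Module.Finite.of_surjective
    ((ev (biprod.inl : N ⟶ N ⊞ M) b).coprod (ev (biprod.inr : M ⟶ N ⊞ M) b)) fun v => ?_
  exact ⟨(ev biprod.fst b v, ev biprod.snd b v), biprod_total_ev v⟩

end Biprod

/-! ### Finite direct sums of indecomposable modules -/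

/-- `E` is an iterated direct sum of `m` indecomposable modules. -/
inductive IndecSum : ℕ → ZnModule k n → Prop
  | zero {E : ZnModule k n} (h : IsZero E) : IndecSum 0 E
  | succ {m : ℕ} {D E F : ZnModule k n} (hD : Indecomposable D) (hE : IndecSum m E)
      (e : F ≅ D ⊞ E) : IndecSum (m + 1) F

theorem IndecSum.of_iso {m : ℕ} {E F : ZnModule k n} (h : IndecSum m E) (e : F ≅ E) :
    IndecSum m F := by
  cases h with
  | zero h => exact .zero (h.of_iso e)
  | succ hD hE e' => exact .succ hD hE (e ≪≫ e')

theorem exists_biprod_iso {X Y : ZnModule k n} (f : X ⟶ Y) [IsSplitMono f] :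
    ∃ e : X ⊞ cokernel f ≅ Y, biprod.inl ≫ e.hom = f := by
  refine ⟨(biprod.uniqueUpToIso _ _
    (isBilimitBinaryBiconeOfIsSplitMonoOfCokernel (cokernelIsCokernel f))).symm, ?_⟩
  exact biprod.inl_desc _ _

theorem exists_biprod_iso_of_injective {X Y : ZnModule k n} (f : X ⟶ Y) [Mono f] [Injective X] :
    ∃ e : X ⊞ cokernel f ≅ Y, biprod.inl ≫ e.hom = f := by
  have : IsSplitMono f := .mk' ⟨Injective.factorThru (𝟙 X) f, Injective.comp_factorThru _ _⟩
  exact exists_biprod_iso f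

/-- Interchange of the first two of three direct summands. -/
noncomputable def biprodLeftComm (A B C : ZnModule k n) : A ⊞ (B ⊞ C) ≅ B ⊞ (A ⊞ C) where
  hom := biprod.lift (biprod.snd ≫ biprod.fst) (biprod.lift biprod.fst (biprod.snd ≫ biprod.snd))
  inv := biprod.lift (biprod.snd ≫ biprod.fst) (biprod.lift biprod.fst (biprod.snd ≫ biprod.snd))
  hom_inv_id := biprod.hom_ext _ _ (by simp) (biprod.hom_ext _ _ (by simp) (by simp))
  inv_hom_id := biprod.hom_ext _ _ (by simp) (biprod.hom_ext _ _ (by simp) (by simp))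

/-- Krull–Schmidt exchange, with locality needed only for `I`. For X ≅ D ⊞ E, the identity of `I` is
the sum of the composites through D and through E, so one is an isomorphism. In the first case I ≅
D, and `I` cancels; in the second `I` splits off E and induction applies. -/
theorem IndecSum.exists_of_biprod_iso {m : ℕ} {I X Y : ZnModule k n} (hI : LocalEnd I)
    (hI0 : ¬ IsZero I) (hX : IndecSum m X) (e : I ⊞ Y ≅ X) : ∃ l, m = l + 1 ∧ IndecSum l Y := by
  induction hX generalizing Y with
  | zero h =>
    refine (hI0 ?_).elim
    rw [IsZero.iff_id_eq_zero, ← biprod.inl_fst (X := I) (Y := Y)]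
    have := (h.of_iso e).eq_of_tgt (biprod.inl : I ⟶ I ⊞ Y) 0
    rw [this, zero_comp]
  | @succ m D E F hD hE φ ih =>
    let ψ : I ⊞ Y ≅ D ⊞ E := e ≪≫ φ
    have hsum : (biprod.inl ≫ ψ.hom ≫ biprod.fst) ≫ (biprod.inl ≫ ψ.inv ≫ biprod.fst) +
        (biprod.inl ≫ ψ.hom ≫ biprod.snd) ≫ (biprod.inr ≫ ψ.inv ≫ biprod.fst) = 𝟙 I := by
      have h1 : biprod.inl ≫ ψ.hom ≫ (biprod.fst ≫ biprod.inl + biprod.snd ≫ biprod.inr) ≫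
          ψ.inv ≫ biprod.fst = 𝟙 I := by
        rw [biprod.total, Category.id_comp, Iso.hom_inv_id_assoc, biprod.inl_fst]
      rw [← h1]
      simp only [Preadditive.add_comp, Preadditive.comp_add, Category.assoc]
    rcases hI _ _ hsum with h | h
    · have hs : IsSplitMono (biprod.inl ≫ ψ.hom ≫ biprod.fst) :=
        .mk' ⟨(biprod.inl ≫ ψ.inv ≫ biprod.fst) ≫ inv ((biprod.inl ≫ ψ.hom ≫ biprod.fst) ≫
          (biprod.inl ≫ ψ.inv ≫ biprod.fst)), by rw [← Category.assoc]; exact IsIso.hom_inv_id _⟩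
      obtain ⟨t, -⟩ := exists_biprod_iso (biprod.inl ≫ ψ.hom ≫ biprod.fst)
      have hz := (hD.2 _ _ t.symm).resolve_left hI0
      have : Epi (biprod.inl ≫ ψ.hom ≫ biprod.fst) :=
        Preadditive.epi_of_isZero_cokernel _ hz
      have : IsIso (biprod.inl ≫ ψ.hom ≫ biprod.fst) := isIso_of_mono_of_epi _
      exact ⟨m, rfl, hE.of_iso (Biprod.isoElim ψ)⟩
    · have hs : IsSplitMono (biprod.inl ≫ ψ.hom ≫ biprod.snd) :=
        .mk' ⟨(biprod.inr ≫ ψ.inv ≫ biprod.fst) ≫ inv ((biprod.inl ≫ ψ.hom ≫ biprod.snd) ≫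
          (biprod.inr ≫ ψ.inv ≫ biprod.fst)), by rw [← Category.assoc]; exact IsIso.hom_inv_id _⟩
      obtain ⟨t, ht⟩ := exists_biprod_iso (biprod.inl ≫ ψ.hom ≫ biprod.snd)
      obtain ⟨l, rfl, hl⟩ := ih t
      refine ⟨l + 1, rfl, ?_⟩
      -- The component of this isomorphism from `I` to `I` is the identity, so Gaussian elimination
      -- cancels `I`.
      let χ : I ⊞ Y ≅ I ⊞ (D ⊞ cokernel (biprod.inl ≫ ψ.hom ≫ biprod.snd)) :=
        ψ ≪≫ biprod.mapIso (Iso.refl _) t.symm ≪≫ biprodLeftComm _ _ _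
      have : biprod.inl ≫ χ.hom ≫ biprod.fst = 𝟙 I := by
        have h2 : biprod.inl ≫ χ.hom ≫ biprod.fst =
            (biprod.inl ≫ ψ.hom ≫ biprod.snd) ≫ t.inv ≫ biprod.fst := by
          simp [χ, biprodLeftComm]
        refine h2.trans ((ht.symm =≫ _).trans ?_)
        simp
      have : IsIso (biprod.inl ≫ χ.hom ≫ biprod.fst) := by
        rw [this]
        infer_instance
      exact .succ hD hl (Biprod.isoElim χ)

/-- The two projectors of a decomposition sum to the identity; one is invertible, yet it kills the
complementary summand. -/
theorem indecomposable_of_localEnd {I : ZnModule k n} (hI : LocalEnd I) (hI0 : ¬ IsZero I) :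
    Indecomposable I := by
  refine ⟨hI0, fun Y Z e => ?_⟩
  have hsum : e.hom ≫ biprod.fst ≫ biprod.inl ≫ e.inv +
      e.hom ≫ biprod.snd ≫ biprod.inr ≫ e.inv = 𝟙 I := by
    have : e.hom ≫ (biprod.fst ≫ biprod.inl + biprod.snd ≫ biprod.inr) ≫ e.inv = 𝟙 I := by
      rw [biprod.total, Category.id_comp, Iso.hom_inv_id]
    rw [← this]
    simp only [Preadditive.add_comp, Preadditive.comp_add, Category.assoc]
  rcases hI _ _ hsum with h | h
  · right
    rw [IsZero.iff_id_eq_zero, ← biprod.inr_snd (X := Y) (Y := Z)]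
    have h0 : (biprod.inr : Z ⟶ Y ⊞ Z) ≫ e.inv = 0 := by
      rw [← cancel_mono (e.hom ≫ biprod.fst ≫ biprod.inl ≫ e.inv)]
      simp
    rw [← e.inv_hom_id_assoc (biprod.snd : Y ⊞ Z ⟶ Z), reassoc_of% h0, zero_comp]
  · left
    rw [IsZero.iff_id_eq_zero, ← biprod.inl_fst (X := Y) (Y := Z)]
    have h0 : (biprod.inl : Y ⟶ Y ⊞ Z) ≫ e.inv = 0 := by
      rw [← cancel_mono (e.hom ≫ biprod.snd ≫ biprod.inr ≫ e.inv)]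
      simp
    rw [← e.inv_hom_id_assoc (biprod.fst : Y ⊞ Z ⟶ Y), reassoc_of% h0, zero_comp]

theorem indecomposable_orthant (S : Set (Fin n)) (a : ZnDegree n) :
    Indecomposable (orthant k S a) :=
  indecomposable_of_localEnd (localEnd_orthant S a) (orthant_not_isZero S a)

/-- Splitting off the first of finitely many summands. -/
theorem nonempty_coproduct_iso_fin {m : ℕ} (D : Fin (m + 1) → ZnModule k n) :
    Nonempty (∐ D ≅ D 0 ⊞ ∐ fun i : Fin m => D i.succ) :=
  ⟨(colimit.isColimit (Discrete.functor D)).coconePointUniqueUpToIso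
    (extendCofanIsColimit D (coproductIsCoproduct fun i : Fin m => D i.succ)
      (BinaryBiproduct.isColimit (D 0) (∐ fun i : Fin m => D i.succ)))⟩

/-- Allows summands to be peeled off one at a time by induction. -/
theorem isSumOfIndecomposables_iff {E : ZnModule k n} {m : ℕ} :
    E.IsSumOfIndecomposables m ↔ IndecSum m E := by
  constructor
  · rintro ⟨D, hD, ⟨e⟩⟩
    refine IndecSum.of_iso ?_ e
    clear e
    induction m with
    | zero =>
      refine .zero ?_
      rw [IsZero.iff_id_eq_zero]
      exact Sigma.hom_ext _ _ fun i => i.elim0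
    | succ m ih =>
      obtain ⟨e⟩ := nonempty_coproduct_iso_fin D
      exact .succ (hD 0) (ih _ fun i => hD i.succ) e
  · intro h
    induction h with
    | zero h =>
      refine ⟨fun i => i.elim0, fun i => i.elim0, ⟨h.iso ?_⟩⟩
      rw [IsZero.iff_id_eq_zero]
      exact Sigma.hom_ext _ _ fun i => i.elim0
    | @succ m D E F hD hE e ih =>
      obtain ⟨D', hD', ⟨e'⟩⟩ := ih
      obtain ⟨t⟩ := nonempty_coproduct_iso_fin (Fin.cons D D' : Fin (m + 1) → ZnModule k n)
      refine ⟨Fin.cons D D', Fin.cases hD hD', ⟨e ≪≫ biprod.mapIso (Iso.refl _) e' ≪≫ t.symm⟩⟩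

theorem IndecSum.numSummands_le {E : ZnModule k n} {m : ℕ} (h : IndecSum m E) :
    E.numSummands ≤ m :=
  iInf₂_le m (isSumOfIndecomposables_iff.mpr h)

theorem exists_indecSum_of_numSummands_ne_top {E : ZnModule k n} (h : E.numSummands ≠ ⊤) :
    ∃ m : ℕ, E.numSummands = m ∧ IndecSum m E := by
  have hne : Nonempty {m : ℕ // E.IsSumOfIndecomposables m} := by
    by_contra hne
    apply h
    rw [numSummands, iInf_subtype']
    rw [not_nonempty_iff] at hne
    exact iInf_of_empty _
  rw [numSummands, iInf_subtype']
  obtain ⟨m, hm⟩ := ENat.exists_eq_iInf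
    (fun m : {m : ℕ // E.IsSumOfIndecomposables m} => ((m : ℕ) : ℕ∞))
  exact ⟨m, hm.symm, isSumOfIndecomposables_iff.mp m.2⟩

/-! ### Finite direct sums of indecomposable injectives -/

theorem injective_of_biprod_iso {X Y E : ZnModule k n} (e : X ⊞ Y ≅ E) [Injective E] :
    Injective Y := by
  have : Injective (X ⊞ Y) := Injective.of_iso e.symm inferInstance
  exact (Retract.mk (biprod.inr : Y ⟶ X ⊞ Y) biprod.snd (by simp)).injective

/-- Splitting an orthant module off a nonzero injective module. -/
theorem exists_orthant_biprod_iso {E : ZnModule k n} [Injective E] (h : ¬ IsZero E) :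
    ∃ (S : Set (Fin n)) (a : ZnDegree n) (E' : ZnModule k n),
      Nonempty (orthant k S a ⊞ E' ≅ E) ∧ Injective E' := by
  obtain ⟨S, a, g, hg⟩ := exists_orthant_mono h
  obtain ⟨e, -⟩ := exists_biprod_iso_of_injective g
  exact ⟨S, a, _, ⟨e⟩, injective_of_biprod_iso e⟩

/-- A nonzero injective splits off an orthant, and exchange leaves an injective complement with one
summand fewer. -/
theorem IndecSum.finitelyDetermined {m : ℕ} {E : ZnModule k n} [Injective E] (h : IndecSum m E) :
    E.FinitelyDetermined := by
  induction m generalizing E with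
  | zero =>
    cases h with
    | zero h => exact .of_isZero h
  | succ m ih =>
    by_cases hE : IsZero E
    · exact .of_isZero hE
    · obtain ⟨S, a, E', ⟨e⟩, hE'⟩ := exists_orthant_biprod_iso hE
      obtain ⟨l, hl, h'⟩ := h.exists_of_biprod_iso (localEnd_orthant S a) (orthant_not_isZero S a) e
      obtain rfl : m = l := by omega
      exact ((orthant_finitelyDetermined S a).biprod (ih h')).of_iso e.symm

/-- Injective direct summands of finite direct sums of indecomposables. -/
theorem IndecSum.exists_of_injective_summand {m : ℕ} {X R E : ZnModule k n} [Injective X]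
    (h : IndecSum m E) (e : X ⊞ R ≅ E) : ∃ l, IndecSum l X := by
  induction m generalizing X E with
  | zero =>
    cases h with
    | zero h =>
      refine ⟨0, .zero ?_⟩
      rw [IsZero.iff_id_eq_zero, ← biprod.inl_fst (X := X) (Y := R)]
      have := (h.of_iso e).eq_of_tgt (biprod.inl : X ⟶ X ⊞ R) 0
      rw [this, zero_comp]
  | succ m ih =>
    by_cases hX : IsZero X
    · exact ⟨0, .zero hX⟩
    · obtain ⟨S, a, X', ⟨t⟩, hX'⟩ := exists_orthant_biprod_iso hX
      let e' : orthant k S a ⊞ (X' ⊞ R) ≅ E :=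
        (biprod.associator _ _ _).symm ≪≫ biprod.mapIso t (Iso.refl _) ≪≫ e
      obtain ⟨l, hl, h'⟩ := h.exists_of_biprod_iso (localEnd_orthant S a) (orthant_not_isZero S a) e'
      obtain rfl : m = l := by omega
      obtain ⟨l', hl'⟩ := ih h' (Iso.refl _)
      exact ⟨l' + 1, .succ (indecomposable_orthant S a) hl' t.symm⟩

/-- The summands of a coproduct which is a finite direct sum of indecomposables. -/
theorem exists_indecSum_of_coproduct (X : ℕ → ZnModule k n) [∀ i, Injective (X i)]
    (h : (∐ X).HasFinitelyManySummands) (i : ℕ) : ∃ m, IndecSum m (X i) := by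
  obtain ⟨m, hm⟩ := h
  obtain ⟨e, -⟩ := exists_biprod_iso_of_injective (Sigma.ι X i)
  exact (isSumOfIndecomposables_iff.mp hm).exists_of_injective_summand e

/-- Splitting off the first of countably many summands. -/
theorem nonempty_coproduct_iso_nat (X : ℕ → ZnModule k n) :
    Nonempty (∐ X ≅ X 0 ⊞ ∐ fun i => X (i + 1)) := by
  refine ⟨⟨Sigma.desc fun i => match i with
    | 0 => biprod.inl
    | i + 1 => Sigma.ι (fun i => X (i + 1)) i ≫ biprod.inr,
    biprod.desc (Sigma.ι X 0) (Sigma.desc fun i => Sigma.ι X (i + 1)), ?_, ?_⟩⟩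
  · refine Sigma.hom_ext _ _ fun i => ?_
    cases i <;> simp
  · refine biprod.hom_ext' _ _ ?_ (Sigma.hom_ext _ _ fun i => ?_) <;> simp

theorem IndecSum.biprod {l m : ℕ} {X Y : ZnModule k n} (hX : IndecSum l X) (hY : IndecSum m Y) :
    ∃ r, IndecSum r (X ⊞ Y) := by
  induction hX with
  | @zero X h =>
    refine ⟨m, hY.of_iso ⟨biprod.snd, biprod.inr, ?_, by simp⟩⟩
    refine biprod.hom_ext' _ _ (h.eq_of_src _ _) (by simp)
  | @succ l D E F hD hE e ih =>
    obtain ⟨r, hr⟩ := ih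
    exact ⟨r + 1, .succ hD hr (biprod.mapIso e (Iso.refl _) ≪≫ biprod.associator _ _ _)⟩

theorem exists_indecSum_coproduct (X : ℕ → ZnModule k n) (hX : ∀ i, ∃ m, IndecSum m (X i)) (l : ℕ)
    (hl : ∀ i, l ≤ i → IsZero (X i)) : ∃ m, IndecSum m (∐ X) := by
  induction l generalizing X with
  | zero =>
    refine ⟨0, .zero ?_⟩
    rw [IsZero.iff_id_eq_zero]
    exact Sigma.hom_ext _ _ fun i => (hl i i.zero_le).eq_of_src _ _
  | succ l ih =>
    obtain ⟨m, hm⟩ := ih (fun i => X (i + 1)) (fun i => hX _) fun i hi => hl _ (by omega)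
    obtain ⟨m', hm'⟩ := hX 0
    obtain ⟨e⟩ := nonempty_coproduct_iso_nat X
    obtain ⟨r, hr⟩ := hm'.biprod hm
    exact ⟨r, hr.of_iso e⟩

/-! ### Essential homomorphisms and minimal injective hulls -/

/-- Every nonzero element of `E` has a nonzero multiple in the image of `f`. -/
def IsEssential {N E : ZnModule k n} (f : N ⟶ E) : Prop :=
  ∀ b (v : E.obj b), v ≠ 0 → ∃ (c : ZnDegree n) (h : b ≤ c), E.tr h v ≠ 0 ∧
    ∃ u, ev f c u = E.tr h v

/-- An element without nonzero multiples in the image yields an orthant summand meeting the image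
trivially. Dividing it out leaves an injective hull with fewer summands; finiteness of the count
makes the drop strict. -/
theorem IsMinimalInjectiveHull.isEssential {N E : ZnModule k n} {f : N ⟶ E}
    (hf : IsMinimalInjectiveHull f) {m : ℕ} (hE : IndecSum m E) : IsEssential f := by
  obtain ⟨⟨hmono, hinj⟩, hmin⟩ := hf
  intro b₀ v₀ hv₀
  by_contra! hcon
  obtain ⟨b, hb, S, hv⟩ := exists_isCogenerator v₀ hv₀
  obtain ⟨g, hg, hgm⟩ := hv.exists_hom
  obtain ⟨e, he⟩ := exists_biprod_iso_of_injective g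
  have hinj' := injective_of_biprod_iso e
  have hfi := (mono_iff_ev f).mp hmono
  have hhull : IsInjectiveHull (f ≫ cokernel.π g) := by
    refine ⟨(mono_iff_ev _).mpr fun c => ?_, hinj'⟩
    rw [injective_iff_map_eq_zero]
    intro x hx
    rw [ev_comp, ev_cokernel_π] at hx
    obtain ⟨y, hy⟩ := hx
    by_contra hx0
    have hy0 : y ≠ 0 := by
      rintro rfl
      rw [map_zero] at hy
      exact hx0 (hfi c (by rw [← hy, map_zero]))
    have hc : Below S b c := by_contra fun hc => hy0 (orthant_eq_zero hc y)
    obtain ⟨r, rfl⟩ := exists_smul_orthantOne y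
    have hr : r ≠ 0 := by
      rintro rfl
      exact hy0 (zero_smul _ _)
    have h1 := ev_tr g (b.le_join_left c) (orthantOne S b b)
    have h2 := ev_tr g (b.le_join_right c) (orthantOne S b c)
    rw [tr_orthantOne] at h1 h2
    rw [hg, tr_tr] at h1
    have hne : E.tr (hb.trans (b.le_join_left c)) v₀ ≠ 0 := by
      rw [← tr_tr hb (b.le_join_left c)]
      exact hv.tr_ne_zero _ _ fun i hi => max_eq_left (hc i hi)
    refine hcon _ _ hne (r⁻¹ • N.tr (b.le_join_right c) x) ?_
    rw [map_smul, ev_tr, ← hy, map_smul, map_smul, smul_smul, inv_mul_cancel₀ hr, one_smul, ← h2]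
    exact h1
  have hle := hmin _ _ hhull
  obtain ⟨l, hl, hEl⟩ := exists_indecSum_of_numSummands_ne_top
    (hE.numSummands_le.trans_lt (ENat.natCast_lt_top m)).ne
  obtain ⟨l', rfl, hl'⟩ := hEl.exists_of_biprod_iso (localEnd_orthant S b)
    (orthant_not_isZero S b) e
  have := hle.trans hl'.numSummands_le
  rw [hl] at this
  norm_cast at this
  omega

/-- Essential injective homomorphisms into injective modules are unique up to isomorphism. -/
theorem isIso_of_isEssential {N M E F : ZnModule k n} {f : N ⟶ E} {g : M ⟶ F} (e : N ⟶ M) [IsIso e]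
    (φ : E ⟶ F) (h : f ≫ φ = e ≫ g) [Injective E] (hg' : Mono g)
    (hf : IsEssential f) (hg : IsEssential g) : IsIso φ := by
  have hgi := (mono_iff_ev g).mp hg'
  have hei := (isIso_iff_ev e).mp inferInstance
  have hev : ∀ b u, ev φ b (ev f b u) = ev g b (ev e b u) := fun b u => by
    rw [← ev_comp, h, ev_comp]
  have hmono : Mono φ := by
    refine (mono_iff_ev φ).mpr fun b => ?_
    rw [injective_iff_map_eq_zero]
    intro v hv
    by_contra hv0
    obtain ⟨c, hc, hne, u, hu⟩ := hf b v hv0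
    have h1 : ev g c (ev e c u) = 0 := by
      rw [← hev, hu, ev_tr, hv, map_zero]
    have h2 : u = 0 := (hei c).1 (by rw [map_zero]; exact hgi c (by rw [h1, map_zero]))
    rw [h2, map_zero] at hu
    exact hne hu.symm
  let r : F ⟶ E := Injective.factorThru (𝟙 E) φ
  have hr : ∀ b v, ev r b (ev φ b v) = v := fun b v => by
    rw [← ev_comp, Injective.comp_factorThru, ev_id]
  have hepi : Epi φ := by
    refine (epi_iff_ev φ).mpr fun b w => ⟨ev r b w, ?_⟩
    by_contra hw
    -- The retraction `r` kills this difference, hence also its multiple in the image of `g`; but on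
    -- that image `r` is injective.
    have hw0 : w - ev φ b (ev r b w) ≠ 0 := fun h0 => hw (sub_eq_zero.mp h0).symm
    obtain ⟨c, hc, hne, u, hu⟩ := hg b _ hw0
    obtain ⟨u', rfl⟩ := (hei c).2 u
    have h1 : ev f c u' = 0 := by
      rw [← hr c (ev f c u'), hev, hu, ev_tr, map_sub, hr, sub_self, map_zero]
    rw [← hev, h1, map_zero] at hu
    exact hne hu.symm
  exact isIso_of_mono_of_epi φ

/-! ### Finitely determined modules have finite injective hulls -/

/-- The degrees in the box `[lo, max lo (hi + 1)]`. -/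
noncomputable def box (lo hi : ZnDegree n) : Finset (ZnDegree n) :=
  (Finset.Icc (α := Fin n → ℤ) lo fun i => max (lo i) (hi i + 1) : Finset (Fin n → ℤ))

theorem mem_box {lo hi a : ZnDegree n} :
    a ∈ box lo hi ↔ ∀ i, lo i ≤ a i ∧ a i ≤ max (lo i) (hi i + 1) :=
  (Finset.mem_Icc (α := Fin n → ℤ)).trans forall_and.symm

/-- Each coordinate of b is clamped to the box. The upper end involves hi + 1 because the step from
hi to hi + 1 need not be an isomorphism. -/
theorem exists_mem_box (lo hi b : ZnDegree n) : ∃ a ∈ box lo hi,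
    ∀ N : ZnModule k n, N.HasBounds lo hi → Function.Bijective (N.tr (b.le_join_left a)) ∧
      Function.Bijective (N.tr (b.le_join_right a)) := by
  let a : ZnDegree n := fun i => max (lo i) (min (b i) (hi i + 1))
  have hai : ∀ i, a i = max (lo i) (min (b i) (hi i + 1)) := fun i => rfl
  have hji : ∀ i, b.join a i = max (b i) (a i) := fun i => rfl
  refine ⟨a, mem_box.mpr fun i => ⟨le_max_left _ _, ?_⟩, fun N h => ⟨?_, ?_⟩⟩
  · exact max_le_max le_rfl (min_le_right _ _)
  all_goals
    refine tr_bijective N _ fun i d hd hdc hlt => h i d ?_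
    have h2 := ZnDegree.le_apply hd i
    rw [hji] at hlt
    have := hai i
    omega

/-- Among homomorphisms to finite injectives with the same bounds as `N`, one minimizes the total
kernel dimension over the box. A surviving kernel element could be detected by one more orthant;
zero kernel on the box then forces zero kernel everywhere. -/
theorem FinitelyDetermined.exists_embedding {N : ZnModule k n} (hN : N.FinitelyDetermined) :
    ∃ (E : ZnModule k n) (f : N ⟶ E), IsInjectiveHull f ∧ ∃ m, IndecSum m E := by
  classical
  obtain ⟨lo, hi, hb⟩ := hN.exists_bounds
  have := hN.1
  let P : ℕ → Prop := fun s => ∃ (E : ZnModule k n) (f : N ⟶ E), Injective E ∧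
    E.HasBounds lo hi ∧ (∃ m, IndecSum m E) ∧
    s = ∑ a ∈ box lo hi, Module.finrank k (LinearMap.ker (ev f a))
  obtain ⟨Z, hZ⟩ : ∃ Z : ZnModule k n, IsZero Z := HasZeroObject.zero
  have hP : ∃ s, P s := ⟨_, Z, 0, hZ.injective, hasBounds_of_isZero hZ lo hi, ⟨0, .zero hZ⟩, rfl⟩
  obtain ⟨E, f, hE, hEb, ⟨m, hm⟩, hs⟩ := Nat.find_spec hP
  have hB : ∀ a ∈ box lo hi, ∀ v : N.obj a, ev f a v = 0 → v = 0 := by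
    intro a ha v hv
    by_contra hv0
    have hlo : ∀ i, lo i ≤ a i := fun i => (mem_box.mp ha i).1
    -- Directions with a_i > hi_i are left unbounded. A degree c ≥ a in this orthant differs from a
    -- only in those directions, where the structure maps of `N` are isomorphisms, so `v` is not
    -- killed on the way.
    let S : Set (Fin n) := {i | a i ≤ hi i}
    obtain ⟨g, hg⟩ := exists_hom_of_injective (E := orthant k S a) v (orthantOne S a a) (by
      intro c hc h0
      rw [tr_orthantOne]
      refine orthant_eq_zero (fun hac => hv0 ?_) _
      refine (tr_bijective N hc fun i d hd hdc hlt => ?_).1 (by rw [h0, map_zero])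
      refine hb i d (Or.inr ?_)
      have h1 := ZnDegree.le_apply hd i
      by_contra! h2
      have h3 : c i ≤ a i := hac i (show a i ≤ hi i by omega)
      omega)
    have hlt : ∑ a ∈ box lo hi, Module.finrank k (LinearMap.ker (ev (biprod.lift g f) a)) <
        Nat.find hP := by
      rw [hs]
      have hf : ∀ b x, ev f b x = ev biprod.snd b (ev (biprod.lift g f) b x) := fun b x => by
        rw [← ev_comp, biprod.lift_snd]
      have hle : ∀ b, LinearMap.ker (ev (biprod.lift g f) b) ≤ LinearMap.ker (ev f b) := by
        intro b x hx
        rw [LinearMap.mem_ker] at hx ⊢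
        rw [hf, hx, map_zero]
      refine Finset.sum_lt_sum (fun b _ => Submodule.finrank_mono (hle b)) ⟨a, ha, ?_⟩
      refine Submodule.finrank_lt_finrank_of_lt ((hle a).lt_of_ne fun heq => ?_)
      have hmem : v ∈ LinearMap.ker (ev (biprod.lift g f) a) := by
        rw [heq]
        exact hv
      rw [LinearMap.mem_ker] at hmem
      have h1 : ev g a v = ev biprod.fst a (ev (biprod.lift g f) a v) := by
        rw [← ev_comp, biprod.lift_fst]
      rw [hmem, map_zero, hg] at h1
      exact orthantOne_ne_zero (below_self S a) h1
    exact Nat.find_min hP hlt ⟨_, biprod.lift g f, inferInstance,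
      (hasBounds_orthant fun i hi' => ⟨hlo i, hi'⟩).biprod hEb,
      ⟨m + 1, .succ (indecomposable_orthant S a) hm (Iso.refl _)⟩, rfl⟩
  refine ⟨E, f, ⟨(mono_iff_ev f).mpr fun b => ?_, hE⟩, m, hm⟩
  rw [injective_iff_map_eq_zero]
  intro v hv
  obtain ⟨a, ha, hab⟩ := exists_mem_box (k := k) lo hi b
  obtain ⟨h1, h2⟩ := hab N hb
  obtain ⟨-, h2'⟩ := hab E hEb
  obtain ⟨w, hw⟩ := h2.2 (N.tr (b.le_join_left a) v)
  have hw0 : w = 0 := by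
    refine hB a ha w (h2'.1 ?_)
    rw [map_zero, ← ev_tr, hw, ev_tr, hv, map_zero]
  apply h1.1
  rw [map_zero, ← hw, hw0, map_zero]

theorem FinitelyDetermined.exists_minimalInjectiveHull {N : ZnModule k n}
    (hN : N.FinitelyDetermined) :
    ∃ (E : ZnModule k n) (f : N ⟶ E), IsMinimalInjectiveHull f ∧ ∃ m, IndecSum m E := by
  obtain ⟨E₀, f₀, hf₀, m₀, hm₀⟩ := hN.exists_embedding
  let H : Set ℕ∞ := {s | ∃ (E : ZnModule k n) (f : N ⟶ E), IsInjectiveHull f ∧ E.numSummands = s}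
  have hH : H.Nonempty := ⟨_, E₀, f₀, hf₀, rfl⟩
  obtain ⟨E, f, hf, hE⟩ := csInf_mem hH
  have hmin : ∀ (E' : ZnModule k n) (f' : N ⟶ E'), IsInjectiveHull f' →
      E.numSummands ≤ E'.numSummands := fun E' f' hf' => by
    rw [hE]
    exact csInf_le' ⟨E', f', hf', rfl⟩
  obtain ⟨m, -, hm⟩ := exists_indecSum_of_numSummands_ne_top (E := E)
    (((hmin E₀ f₀ hf₀).trans hm₀.numSummands_le).trans_lt (ENat.natCast_lt_top m₀)).ne
  exact ⟨E, f, ⟨hf, hmin⟩, m, hm⟩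

/-! ### Koszul acyclicity and the length of resolutions -/

/-- Each variable `x_i` acts surjectively on the elements killed by any set of fewer than `r` other
variables. -/
def KoszulAcyclic (M : ZnModule k n) (r : ℕ) : Prop :=
  ∀ (A : Finset (Fin n)), A.card < r → ∀ i ∉ A, ∀ (b : ZnDegree n) (v : M.obj (b.addUnit i)),
    (∀ j ∈ A, M.tr ((b.addUnit i).le_addUnit j) v = 0) →
    ∃ u : M.obj b, (∀ j ∈ A, M.tr (b.le_addUnit j) u = 0) ∧ M.tr (b.le_addUnit i) u = v

/-- The orthant with corner b bounded in the directions of `A` maps its element in degree b + e_i to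
`v`; the image of its element in degree b is the required preimage. -/
theorem koszulAcyclic_of_injective (E : ZnModule k n) [Injective E] (r : ℕ) :
    E.KoszulAcyclic r := by
  intro A _ i hi b v hv
  have hone : ∀ j ∈ A, ¬ Below (A : Set (Fin n)) b (b.addUnit j) := fun j hj h => by
    have := h j hj
    rw [ZnDegree.addUnit_self] at this
    omega
  obtain ⟨g, hg⟩ := exists_hom_of_injective (M := orthant k (A : Set (Fin n)) b)
    (orthantOne _ b (b.addUnit i)) v (by
      intro c hc h0
      rw [tr_orthantOne] at h0
      have : ¬ Below (A : Set (Fin n)) b c := fun h => orthantOne_ne_zero h h0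
      simp only [Below] at this
      push Not at this
      obtain ⟨j, hj, hlt⟩ := this
      have hji : j ≠ i := fun h => hi (h ▸ hj)
      rw [← ZnDegree.addUnit_of_ne b hji] at hlt
      rw [← tr_tr ((b.addUnit i).le_addUnit j) (ZnDegree.addUnit_le hc hlt), hv j hj, map_zero])
  refine ⟨ev g b (orthantOne _ b b), fun j hj => ?_, ?_⟩
  · rw [← ev_tr, orthant_eq_zero (hone j hj) ((orthant k _ b).tr _ _), map_zero]
  · rw [← ev_tr, tr_orthantOne, hg]

theorem tr_addUnit_comm_eq_zero {M : ZnModule k n} {b : ZnDegree n} {i : Fin n} (j : Fin n)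
    {u : M.obj b} (h : M.tr (b.le_addUnit i) u = 0) :
    M.tr ((b.addUnit j).le_addUnit i) (M.tr (b.le_addUnit j) u) = 0 := by
  have hle : b.addUnit i ≤ (b.addUnit j).addUnit i := by
    intro l
    have : b.addUnit i l ≤ (b.addUnit j).addUnit i l := by
      simp only [ZnDegree.addUnit]
      split_ifs <;> omega
    exact this
  rw [tr_tr, ← tr_tr (b.le_addUnit i) hle, h, map_zero]

section ShortExact

variable {M E M' : ZnModule k n} {f : M ⟶ E} {p : E ⟶ M'} {r : ℕ}

/-- Induction on `A`: if a lift u is killed by `A`, then x_i u comes from `M` and, by acyclicity,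
equals x_i y with y in `M` killed by `A`; replace u by u - y. -/
theorem KoszulAcyclic.exists_lift (hM : M.KoszulAcyclic r)
    (hf : ∀ b, Function.Injective (ev f b)) (hp : ∀ b, Function.Surjective (ev p b))
    (hfp : ∀ b v, ev p b v = 0 ↔ ∃ u, ev f b u = v) (A : Finset (Fin n)) (hA : A.card ≤ r)
    {b : ZnDegree n} (v : M'.obj b) (hv : ∀ j ∈ A, M'.tr (b.le_addUnit j) v = 0) :
    ∃ u : E.obj b, ev p b u = v ∧ ∀ j ∈ A, E.tr (b.le_addUnit j) u = 0 := by
  classical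
  induction A using Finset.induction_on with
  | empty =>
    obtain ⟨u, hu⟩ := hp b v
    exact ⟨u, hu, by simp⟩
  | insert i A hi ih =>
    rw [Finset.card_insert_of_notMem hi] at hA
    obtain ⟨u, hu, hAu⟩ := ih (by omega) fun j hj => hv j (Finset.mem_insert_of_mem hj)
    have h1 : ev p _ (E.tr (b.le_addUnit i) u) = 0 := by
      rw [ev_tr, hu, hv i (Finset.mem_insert_self _ _)]
    obtain ⟨x, hx⟩ := (hfp _ _).mp h1
    obtain ⟨y, hyA, hy⟩ := hM A (by omega) i hi b x fun j hj => hf _ (by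
      rw [ev_tr, hx, map_zero, tr_addUnit_comm_eq_zero i (hAu j hj)])
    refine ⟨u - ev f b y, ?_, fun j hj => ?_⟩
    · rw [map_sub, (hfp b (ev f b y)).mpr ⟨y, rfl⟩, sub_zero, hu]
    · rw [map_sub, ← ev_tr]
      rcases Finset.mem_insert.mp hj with rfl | hj
      · rw [hy, hx, sub_self]
      · rw [hyA j hj, hAu j hj, map_zero, sub_self]

/-- Lift to `E` keeping the annihilators, divide by x_i in the injective `E`, and project back. -/
theorem KoszulAcyclic.quotient (hM : M.KoszulAcyclic r) [Injective E]
    (hf : ∀ b, Function.Injective (ev f b)) (hp : ∀ b, Function.Surjective (ev p b))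
    (hfp : ∀ b v, ev p b v = 0 ↔ ∃ u, ev f b u = v) : M'.KoszulAcyclic (r + 1) := by
  intro A hA i hi b v hv
  obtain ⟨w, hw, hwA⟩ := hM.exists_lift hf hp hfp A (by omega) v hv
  obtain ⟨u, huA, hu⟩ := koszulAcyclic_of_injective E (r + 1) A hA i hi b w hwA
  refine ⟨ev p b u, fun j hj => ?_, ?_⟩
  · rw [← ev_tr, huA j hj, map_zero]
  · rw [← ev_tr, hu, hw]

/-- A Koszul acyclic finitely determined module has no proper essential extensions. -/
theorem KoszulAcyclic.isZero_of_isEssential (hM : M.KoszulAcyclic n)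
    (hf : ∀ b, Function.Injective (ev f b)) (hp : ∀ b, Function.Surjective (ev p b))
    (hfp : ∀ b v, ev p b v = 0 ↔ ∃ u, ev f b u = v) (hess : IsEssential f)
    (hMd : M.FinitelyDetermined) (hEd : E.FinitelyDetermined) : IsZero M' := by
  classical
  by_contra hz
  obtain ⟨b₀, v₀, hv₀⟩ := exists_ne_zero_of_not_isZero hz
  obtain ⟨b, hb, S, hv⟩ := exists_isCogenerator v₀ hv₀
  obtain ⟨lo, hi, hMb, hEb⟩ := hMd.exists_common_bounds hEd
  -- The element is pushed past the upper bounds in all directions outside `S`. Its lift u is killed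
  -- by `S`, so a nonzero multiple of u in `M` arises only along isomorphisms of both `M` and `E`;
  -- hence u itself lies in `M`.
  let c : ZnDegree n := fun i => if i ∈ S then b i else max (b i) (hi i + 1)
  have hcS : ∀ i ∈ S, c i = b i := fun i hi => if_pos hi
  have hcT : ∀ i, i ∉ S → c i = max (b i) (hi i + 1) := fun i hi => if_neg hi
  have hbc : b ≤ c := by
    intro i
    by_cases hi : i ∈ S
    · exact (hcS i hi).ge
    · rw [hcT i hi]
      exact le_max_left _ _
  have hne := hv.tr_ne_zero c hbc hcS
  obtain ⟨u, hu, huS⟩ := hM.exists_lift hf hp hfp S.toFinset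
    ((Finset.card_le_univ _).trans (Fintype.card_fin n).le) (M'.tr hbc (M'.tr hb v₀))
    fun i hi => by
      rw [Set.mem_toFinset] at hi
      rw [tr_tr]
      refine hv.tr_eq_zero_of_lt _ hi ?_
      rw [ZnDegree.addUnit_self, hcS i hi]
      omega
  have hu0 : u ≠ 0 := by
    rintro rfl
    rw [map_zero] at hu
    exact hne hu.symm
  obtain ⟨d, hcd, hd0, x, hx⟩ := hess c u hu0
  have hdS : ∀ i ∈ S, ¬ c i < d i := fun i hi hlt => hd0 (by
    rw [← tr_tr (c.le_addUnit i) (ZnDegree.addUnit_le hcd hlt), huS i (Set.mem_toFinset.mpr hi),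
      map_zero])
  have hpath : ∀ i e, c ≤ e → e ≤ d → e i < d i → hi i < e i := by
    intro i e hce hed hlt
    have h1 := ZnDegree.le_apply hce i
    have h2 := hcT i fun hiS => hdS i hiS (by omega)
    omega
  have hMbij := tr_bijective M hcd fun i e h1 h2 h3 => hMb i e (Or.inr (hpath i e h1 h2 h3))
  have hEbij := tr_bijective E hcd fun i e h1 h2 h3 => hEb i e (Or.inr (hpath i e h1 h2 h3))
  obtain ⟨y, rfl⟩ := hMbij.2 x
  rw [ev_tr] at hx
  have := (hfp c u).mpr ⟨y, hEbij.1 hx⟩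
  exact hne (hu.symm.trans this)

end ShortExact

/-! ### Syzygies of injective resolutions -/

section Resolution

variable {N : ZnModule k n} (E : InjectiveResolution N)

/-- The cosyzygies of an injective resolution. -/
noncomputable def cosyzygy : ℕ → ZnModule k n
  | 0 => N
  | 1 => cokernel (augmentation E)
  | i + 2 => cokernel (E.cocomplex.d i (i + 1))

/-- The homomorphism from a cosyzygy to the corresponding term of the resolution. -/
noncomputable def cosyzygyι : ∀ i, cosyzygy E i ⟶ E.cocomplex.X i
  | 0 => augmentation E
  | 1 => cokernel.desc (augmentation E) (E.cocomplex.d 0 1) E.ι_f_zero_comp_complex_d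
  | i + 2 => cokernel.desc (E.cocomplex.d i (i + 1)) (E.cocomplex.d (i + 1) (i + 2))
      (E.cocomplex.d_comp_d i (i + 1) (i + 2))

/-- The projection of a term of the resolution to the next cosyzygy. -/
noncomputable def cosyzygyπ : ∀ i, E.cocomplex.X i ⟶ cosyzygy E (i + 1)
  | 0 => cokernel.π (augmentation E)
  | i + 1 => cokernel.π (E.cocomplex.d i (i + 1))

theorem cosyzygyπ_ι (i : ℕ) : cosyzygyπ E i ≫ cosyzygyι E (i + 1) = E.cocomplex.d i (i + 1) := by
  cases i <;> exact cokernel.π_desc _ _ _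

theorem cosyzygyπ_surjective (i : ℕ) (b : ZnDegree n) :
    Function.Surjective (ev (cosyzygyπ E i) b) := by
  cases i <;> exact ev_cokernel_π_surjective _ b

/-- From index 2 on, cosyzygies are cokernels of differentials; since the preceding projection is
surjective, the differential and `cosyzygyι` have the same image. -/
theorem cosyzygy_exact (i : ℕ) (b : ZnDegree n) (v : (E.cocomplex.X i).obj b) :
    ev (cosyzygyπ E i) b v = 0 ↔ ∃ u, ev (cosyzygyι E i) b u = v := by
  cases i with
  | zero => exact ev_cokernel_π _ v
  | succ i =>
    refine (ev_cokernel_π (E.cocomplex.d i (i + 1)) v).trans ⟨?_, ?_⟩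
    · rintro ⟨u, rfl⟩
      exact ⟨ev (cosyzygyπ E i) b u, by rw [← ev_comp, cosyzygyπ_ι]⟩
    · rintro ⟨u, rfl⟩
      obtain ⟨w, rfl⟩ := cosyzygyπ_surjective E i b u
      exact ⟨w, by rw [← ev_comp, cosyzygyπ_ι]⟩

theorem cosyzygyι_π (i : ℕ) : cosyzygyι E i ≫ cosyzygyπ E i = 0 :=
  hom_ext_ev fun b v => (cosyzygy_exact E i b _).mpr ⟨v, rfl⟩

theorem isIso_cokernel_desc {M X Z : ZnModule k n} {f : M ⟶ X} {p : X ⟶ Z} (w : f ≫ p = 0)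
    (hp : ∀ b, Function.Surjective (ev p b))
    (hfp : ∀ b v, ev p b v = 0 ↔ ∃ u, ev f b u = v) : IsIso (cokernel.desc f p w) := by
  have hd : ∀ b v, ev (cokernel.desc f p w) b (ev (cokernel.π f) b v) = ev p b v := fun b v => by
    rw [← ev_comp, cokernel.π_desc]
  refine (isIso_iff_ev _).mpr fun b => ⟨?_, fun v => ?_⟩
  · rw [injective_iff_map_eq_zero]
    intro x hx
    obtain ⟨y, rfl⟩ := ev_cokernel_π_surjective f b x
    rw [hd, hfp] at hx
    exact (ev_cokernel_π f y).mpr hx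
  · obtain ⟨y, rfl⟩ := hp b v
    exact ⟨_, hd b y⟩

variable {E}

theorem IsMinimalResolution.cosyzygyι (h : IsMinimalResolution E) (i : ℕ) :
    IsMinimalInjectiveHull (cosyzygyι E i) :=
  match i with
  | 0 => h.augmentation_minimal
  | 1 => h.zero_minimal
  | i + 2 => h.succ_minimal i

theorem IsFiniteResolution.exists_indecSum (h : IsFiniteResolution E) (i : ℕ) :
    ∃ m, IndecSum m (E.cocomplex.X i) :=
  exists_indecSum_of_coproduct _ h i

theorem finitelyDetermined_of_resolution (h : ∀ i, ∃ m, IndecSum m (E.cocomplex.X i)) :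
    N.FinitelyDetermined := by
  obtain ⟨m₀, h₀⟩ := h 0
  obtain ⟨m₁, h₁⟩ := h 1
  refine .of_left_exact (augmentation E) (E.cocomplex.d 0 1) ?_ (fun b v => ?_)
    h₀.finitelyDetermined h₁.finitelyDetermined
  · exact (mono_iff_ev _).mp (inferInstanceAs (Mono (E.ι.f 0)))
  · exact ev_exact E.exact₀ b v

/-- The i-th cosyzygy is Koszul acyclic to order i, so the n-th already fills its hull. Finiteness
is assumed only termwise, since the bound is used to prove finiteness of the constructed resolution.
-/
theorem lengthAtMost_of_isMinimalResolution (h : ∀ i, ∃ m, IndecSum m (E.cocomplex.X i))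
    (hmin : IsMinimalResolution E) : LengthAtMost E n := by
  have hXd : ∀ i, (E.cocomplex.X i).FinitelyDetermined := fun i =>
    (h i).choose_spec.finitelyDetermined
  have hess : ∀ i, IsEssential (cosyzygyι E i) := fun i =>
    (hmin.cosyzygyι i).isEssential (h i).choose_spec
  have hinj : ∀ i b, Function.Injective (ev (cosyzygyι E i) b) := fun i =>
    (mono_iff_ev _).mp (hmin.cosyzygyι i).1.1
  have hd : ∀ i, (cosyzygy E i).FinitelyDetermined := by
    intro i
    induction i with
    | zero => exact finitelyDetermined_of_resolution h
    | succ i ih =>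
      exact .of_right_exact _ _ (cosyzygyπ_surjective E i) (cosyzygy_exact E i) ih (hXd i)
  have hac : ∀ i, (cosyzygy E i).KoszulAcyclic i := by
    intro i
    induction i with
    | zero => exact fun A hA => absurd hA (Nat.not_lt_zero _)
    | succ i ih => exact ih.quotient (hinj i) (cosyzygyπ_surjective E i) (cosyzygy_exact E i)
  have hX : ∀ i, IsZero (cosyzygy E i) → IsZero (E.cocomplex.X i) := by
    intro i hi
    rw [isZero_iff_forall] at hi ⊢
    intro b v
    by_contra hv
    obtain ⟨c, hc, hne, u, hu⟩ := hess i b v hv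
    rw [hi c u, map_zero] at hu
    exact hne hu.symm
  intro i hi
  apply hX
  induction i, hi using Nat.le_induction with
  | base =>
    exact (hac n).isZero_of_isEssential (hinj n) (cosyzygyπ_surjective E n) (cosyzygy_exact E n)
      (hess n) (hd n) (hXd n)
  | succ i _ ih =>
    have := (isZero_iff_forall _).mp (hX i ih)
    rw [isZero_iff_forall]
    intro b v
    obtain ⟨w, rfl⟩ := cosyzygyπ_surjective E i b v
    rw [this b w, map_zero]

/-- A comparison map over the identity of `N` is itself an isomorphism: an isomorphism of cosyzygies
induces one of essential hulls, and hence one of the next cosyzygies. -/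
theorem exists_iso_of_isMinimalResolution {E F : InjectiveResolution N}
    (hE : IsFiniteResolution E) (hE' : IsMinimalResolution E)
    (hF : IsFiniteResolution F) (hF' : IsMinimalResolution F) :
    ∃ φ : E.cocomplex ≅ F.cocomplex, E.ι ≫ φ.hom = F.ι := by
  let φ := (InjectiveResolution.homotopyEquiv E F).hom
  have hφ : E.ι ≫ φ = F.ι := InjectiveResolution.homotopyEquiv_hom_ι E F
  have hessE : ∀ i, IsEssential (ZnModule.cosyzygyι E i) := fun i =>
    (hE'.cosyzygyι i).isEssential (hE.exists_indecSum i).choose_spec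
  have hessF : ∀ i, IsEssential (ZnModule.cosyzygyι F i) := fun i =>
    (hF'.cosyzygyι i).isEssential (hF.exists_indecSum i).choose_spec
  have key : ∀ i, ∃ e : cosyzygy E i ⟶ cosyzygy F i, IsIso e ∧
      ZnModule.cosyzygyι E i ≫ φ.f i = e ≫ ZnModule.cosyzygyι F i := by
    intro i
    induction i with
    | zero =>
      exact ⟨𝟙 N, inferInstanceAs (IsIso (𝟙 N)),
        (HomologicalComplex.congr_hom hφ 0).trans (Category.id_comp (augmentation F)).symm⟩
    | succ i ih =>
      obtain ⟨e, he, hcomm⟩ := ih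
      have hiso : IsIso (φ.f i) := isIso_of_isEssential e (φ.f i) hcomm (hF'.cosyzygyι i).1.1
        (hessE i) (hessF i)
      have hcE := cosyzygyι_π E i
      have hcF := cosyzygyι_π F i
      have hE1 := isIso_cokernel_desc hcE (cosyzygyπ_surjective E i) (cosyzygy_exact E i)
      have hF1 := isIso_cokernel_desc hcF (cosyzygyπ_surjective F i) (cosyzygy_exact F i)
      let t := cokernel.mapIso (ZnModule.cosyzygyι E i) (ZnModule.cosyzygyι F i)
        (asIso e) (asIso (φ.f i)) hcomm
      have hπE : cokernel.π _ = cosyzygyπ E i ≫ inv (cokernel.desc _ _ hcE) := by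
        rw [IsIso.eq_comp_inv, cokernel.π_desc]
      have hE2 : cosyzygyπ E i ≫ inv (cokernel.desc _ _ hcE) ≫ t.hom ≫ cokernel.desc _ _ hcF =
          φ.f i ≫ cosyzygyπ F i := by
        have ht : cokernel.π _ ≫ t.hom = φ.f i ≫ cokernel.π _ := cokernel.π_desc _ _ _
        rw [← reassoc_of% hπE, reassoc_of% ht, cokernel.π_desc]
      refine ⟨inv (cokernel.desc _ _ hcE) ≫ t.hom ≫ cokernel.desc _ _ hcF, inferInstance, ?_⟩
      have : Epi (cosyzygyπ E i) := (epi_iff_ev _).mpr (cosyzygyπ_surjective E i)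
      rw [← cancel_epi (cosyzygyπ E i), ← Category.assoc, cosyzygyπ_ι, ← φ.comm,
        ← cosyzygyπ_ι F i, ← reassoc_of% hE2]
      simp only [Category.assoc]
  have hiso : ∀ i, IsIso (φ.f i) := fun i => by
    obtain ⟨e, he, hcomm⟩ := key i
    exact isIso_of_isEssential e (φ.f i) hcomm (hF'.cosyzygyι i).1.1 (hessE i) (hessF i)
  have : IsIso φ := HomologicalComplex.Hom.isIso_of_components φ
  exact ⟨asIso φ, hφ⟩

end Resolution

/-! ### Construction of minimal resolutions -/

theorem IsMinimalInjectiveHull.iso_comp {N M E : ZnModule k n} {f : N ⟶ E}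
    (hf : IsMinimalInjectiveHull f) (e : M ≅ N) : IsMinimalInjectiveHull (e.hom ≫ f) := by
  obtain ⟨⟨hmono, hinj⟩, hmin⟩ := hf
  refine ⟨⟨inferInstance, hinj⟩, fun E' f' hf' => hmin E' (e.inv ≫ f') ?_⟩
  obtain ⟨hmono', hinj'⟩ := hf'
  exact ⟨inferInstance, hinj'⟩

/-- Precomposing with an epimorphism does not change the cokernel, so minimality passes from
cokernels of hulls to cokernels of differentials. -/
theorem IsMinimalInjectiveHull.desc {X M E Y : ZnModule k n} {p : X ⟶ M} [Epi p] {f : M ⟶ E}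
    {g : cokernel f ⟶ Y} (hg : IsMinimalInjectiveHull g) {a : X ⟶ E} {b : E ⟶ Y}
    (ha : a = p ≫ f) (hb : b = cokernel.π f ≫ g) (w : a ≫ b = 0) :
    IsMinimalInjectiveHull (cokernel.desc a b w) := by
  subst ha hb
  convert hg.iso_comp (cokernelEpiComp p f) using 1
  refine (cancel_epi (cokernel.π (p ≫ f))).mp ?_
  simp [cokernelEpiComp]

/-- An epimorphism in front preserves the image and a monomorphism behind preserves the kernel. -/
theorem exact_of_epi_of_mono {X M E Y : ZnModule k n} {p : X ⟶ M} (hp : Epi p) {f : M ⟶ E}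
    {g : cokernel f ⟶ Y} (hg : Mono g) (w : (p ≫ f) ≫ cokernel.π f ≫ g = 0) :
    (ShortComplex.mk _ _ w).Exact := by
  let S₁ := ShortComplex.mk f (cokernel.π f ≫ g) (by simp)
  let φ : ShortComplex.mk _ _ w ⟶ S₁ :=
    { τ₁ := p, τ₂ := 𝟙 _, τ₃ := 𝟙 _, comm₁₂ := by simp [S₁], comm₂₃ := by simp [S₁] }
  let ψ : ShortComplex.mk f (cokernel.π f) (cokernel.condition f) ⟶ S₁ :=
    { τ₁ := 𝟙 _, τ₂ := 𝟙 _, τ₃ := g, comm₁₂ := by simp [S₁], comm₂₃ := by simp [S₁] }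
  have h1 : Epi φ.τ₁ := inferInstanceAs (Epi p)
  have h2 : IsIso φ.τ₂ := inferInstanceAs (IsIso (𝟙 _))
  have h3 : Mono φ.τ₃ := inferInstanceAs (Mono (𝟙 _))
  have h4 : Epi ψ.τ₁ := inferInstanceAs (Epi (𝟙 _))
  have h5 : IsIso ψ.τ₂ := inferInstanceAs (IsIso (𝟙 _))
  have h6 : Mono ψ.τ₃ := inferInstanceAs (Mono g)
  rw [ShortComplex.exact_iff_of_epi_of_isIso_of_mono φ,
    ← ShortComplex.exact_iff_of_epi_of_isIso_of_mono ψ]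
  exact ShortComplex.exact_cokernel f

/-- A finite minimal injective hull of a finitely determined module. -/
noncomputable def hull (N : {N : ZnModule k n // N.FinitelyDetermined}) : ZnModule k n :=
  N.2.exists_minimalInjectiveHull.choose

/-- The embedding into the minimal injective hull. -/
noncomputable def hullι (N : {N : ZnModule k n // N.FinitelyDetermined}) : N.1 ⟶ hull N :=
  N.2.exists_minimalInjectiveHull.choose_spec.choose

theorem isMinimalInjectiveHull_hullι (N : {N : ZnModule k n // N.FinitelyDetermined}) :
    IsMinimalInjectiveHull (hullι N) :=
  N.2.exists_minimalInjectiveHull.choose_spec.choose_spec.1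

theorem exists_indecSum_hull (N : {N : ZnModule k n // N.FinitelyDetermined}) :
    ∃ m, IndecSum m (hull N) :=
  N.2.exists_minimalInjectiveHull.choose_spec.choose_spec.2

instance (N : {N : ZnModule k n // N.FinitelyDetermined}) : Injective (hull N) :=
  (isMinimalInjectiveHull_hullι N).1.2

instance (N : {N : ZnModule k n // N.FinitelyDetermined}) : Mono (hullι N) :=
  (isMinimalInjectiveHull_hullι N).1.1

/-- The cokernel of the minimal injective hull. -/
noncomputable def hullCokernel (N : {N : ZnModule k n // N.FinitelyDetermined}) :
    {N : ZnModule k n // N.FinitelyDetermined} :=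
  ⟨cokernel (hullι N), .cokernel _ N.2 (exists_indecSum_hull N).choose_spec.finitelyDetermined⟩

/-- The projection to the cokernel of the minimal injective hull. -/
noncomputable def hullπ (N : {N : ZnModule k n // N.FinitelyDetermined}) :
    hull N ⟶ (hullCokernel N).1 :=
  cokernel.π (hullι N)

instance (N : {N : ZnModule k n // N.FinitelyDetermined}) : Epi (hullπ N) :=
  inferInstanceAs (Epi (cokernel.π _))

theorem hullι_π (N : {N : ZnModule k n // N.FinitelyDetermined}) : hullι N ≫ hullπ N = 0 :=
  cokernel.condition _

/-- The map from the minimal injective hull of a module to that of its cokernel. -/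
noncomputable def hullD (N : {N : ZnModule k n // N.FinitelyDetermined}) :
    hull N ⟶ hull (hullCokernel N) :=
  hullπ N ≫ hullι (hullCokernel N)

theorem hullι_D (N : {N : ZnModule k n // N.FinitelyDetermined}) : hullι N ≫ hullD N = 0 := by
  rw [hullD, ← Category.assoc, hullι_π, zero_comp]

theorem hullD_comp (N : {N : ZnModule k n // N.FinitelyDetermined}) :
    hullD N ≫ hullD (hullCokernel N) = 0 := by
  rw [hullD, Category.assoc, hullι_D, comp_zero]

theorem exact_hullι_D (N : {N : ZnModule k n // N.FinitelyDetermined}) :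
    (ShortComplex.mk _ _ (hullι_D N)).Exact := by
  -- The hull map is written as 𝟙 ≫ `hullι N` to fit the general form with an epimorphism in front.
  have h : ∀ (a : N.1 ⟶ hull N) (w : a ≫ hullD N = 0), a = 𝟙 N.1 ≫ hullι N →
      (ShortComplex.mk a (hullD N) w).Exact := by
    rintro _ w rfl
    exact exact_of_epi_of_mono inferInstance (isMinimalInjectiveHull_hullι (hullCokernel N)).1.1 w
  exact h _ _ (Category.id_comp _).symm

section Minimal

variable (N : {N : ZnModule k n // N.FinitelyDetermined})

/-- The cosyzygies of the minimal resolution. -/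
noncomputable def minimalCosyzygy : ℕ → {N : ZnModule k n // N.FinitelyDetermined}
  | 0 => N
  | i + 1 => hullCokernel (minimalCosyzygy i)

/-- The cochain complex underlying the minimal resolution. -/
noncomputable def minimalComplex : CochainComplex (ZnModule k n) ℕ :=
  CochainComplex.of (fun i => hull (minimalCosyzygy N i)) (fun i => hullD (minimalCosyzygy N i))
    fun i => hullD_comp (minimalCosyzygy N i)

theorem minimalComplex_d (i : ℕ) : (minimalComplex N).d i (i + 1) = hullD (minimalCosyzygy N i) :=
  CochainComplex.of_d (fun i => hull (minimalCosyzygy N i)) (fun i => hullD (minimalCosyzygy N i)) i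

theorem minimalComplex_exactAt_succ (i : ℕ) : (minimalComplex N).ExactAt (i + 1) := by
  rw [HomologicalComplex.exactAt_iff' _ i (i + 1) (i + 1 + 1) (by simp) (by simp)]
  have h : ∀ (a : hull (minimalCosyzygy N i) ⟶ hull (minimalCosyzygy N (i + 1)))
      (b : hull (minimalCosyzygy N (i + 1)) ⟶ hull (minimalCosyzygy N (i + 2))) (w : a ≫ b = 0),
      a = hullD (minimalCosyzygy N i) → b = hullD (minimalCosyzygy N (i + 1)) →
      (ShortComplex.mk a b w).Exact := by
    rintro _ _ w rfl rfl
    exact exact_of_epi_of_mono (p := hullπ (minimalCosyzygy N i)) inferInstance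
      (isMinimalInjectiveHull_hullι (minimalCosyzygy N (i + 2))).1.1 w
  exact h _ _ ((minimalComplex N).d_comp_d _ _ _) (minimalComplex_d N i) (minimalComplex_d N (i + 1))

instance (i : ℕ) : Injective ((minimalComplex N).X i) :=
  inferInstanceAs (Injective (hull (minimalCosyzygy N i)))

/-- The augmentation of the minimal resolution. -/
noncomputable def minimalι : (CochainComplex.single₀ _).obj N.1 ⟶ minimalComplex N :=
  (CochainComplex.fromSingle₀Equiv _ _).symm ⟨hullι N, by
    rw [minimalComplex_d]
    exact hullι_D N⟩

theorem minimalι_f_zero : (minimalι N).f 0 = hullι N :=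
  CochainComplex.fromSingle₀Equiv_symm_apply_f_zero (C := minimalComplex N) _ _

/-- The minimal injective resolution of a finitely determined module. -/
noncomputable def minimalResolution : InjectiveResolution N.1 where
  cocomplex := minimalComplex N
  ι := minimalι N
  quasiIso := ⟨fun i => by
    cases i with
    | zero =>
      rw [CochainComplex.quasiIsoAt₀_iff, ShortComplex.quasiIso_iff_of_zeros]
      · refine (ShortComplex.exact_and_mono_f_iff_of_iso ?_).2
          ⟨exact_hullι_D N, inferInstanceAs (Mono (hullι N))⟩
        refine ShortComplex.isoMk (Iso.refl _) (Iso.refl _) (Iso.refl _) ?_ ?_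
        · refine (Category.id_comp _).trans (Eq.trans ?_ (Category.comp_id _).symm)
          exact (minimalι_f_zero N).symm
        · refine (Category.id_comp _).trans (Eq.trans ?_ (Category.comp_id _).symm)
          exact (minimalComplex_d N 0).symm
      all_goals rfl
    | succ i =>
      rw [quasiIsoAt_iff_exactAt]
      · apply minimalComplex_exactAt_succ
      · apply CochainComplex.exactAt_succ_single_obj⟩

theorem augmentation_minimalResolution : augmentation (minimalResolution N) = hullι N :=
  minimalι_f_zero N

theorem isMinimalResolution_minimalResolution : IsMinimalResolution (minimalResolution N) where
  augmentation_minimal := by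
    rw [augmentation_minimalResolution]
    exact isMinimalInjectiveHull_hullι N
  zero_minimal := by
    refine (isMinimalInjectiveHull_hullι (hullCokernel N)).desc (p := 𝟙 _) (f := hullι N) ?_ ?_ _
    · rw [augmentation_minimalResolution, Category.id_comp]
    · exact minimalComplex_d N 0
  succ_minimal i :=
    (isMinimalInjectiveHull_hullι (minimalCosyzygy N (i + 2))).desc
      (p := hullπ (minimalCosyzygy N i)) (f := hullι (minimalCosyzygy N (i + 1)))
      (minimalComplex_d N i) (minimalComplex_d N (i + 1)) _

theorem exists_indecSum_minimalResolution (i : ℕ) :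
    ∃ m, IndecSum m ((minimalResolution N).cocomplex.X i) :=
  exists_indecSum_hull (minimalCosyzygy N i)

/-- Each term is a finite sum, and the length bound leaves only the terms in degrees at most n. -/
theorem isFiniteResolution_minimalResolution : IsFiniteResolution (minimalResolution N) := by
  obtain ⟨m, hm⟩ := exists_indecSum_coproduct _ (exists_indecSum_minimalResolution N) (n + 1)
    fun i hi => lengthAtMost_of_isMinimalResolution (exists_indecSum_minimalResolution N)
      (isMinimalResolution_minimalResolution N) i hi
  exact ⟨m, isSumOfIndecomposables_iff.mpr hm⟩

end Minimal

end ZnModule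

/-! ### The equivalences, uniqueness and the length bound -/

theorem proposition4p7 (k : Type u) [Field k] (n : ℕ) (N : ZnModule k n) :
    List.TFAE
      [N.FinitelyDetermined,
       ∃ E : InjectiveResolution N, ZnModule.IsFiniteResolution E,
       ∃ E : InjectiveResolution N,
        ZnModule.IsFiniteResolution E ∧ ZnModule.IsMinimalResolution E] ∧
    (∀ E F : InjectiveResolution N,
      ZnModule.IsFiniteResolution E → ZnModule.IsMinimalResolution E →
      ZnModule.IsFiniteResolution F → ZnModule.IsMinimalResolution F →
      ∃ φ : E.cocomplex ≅ F.cocomplex, E.ι ≫ φ.hom = F.ι) ∧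
    (∀ E : InjectiveResolution N,
      ZnModule.IsFiniteResolution E → ZnModule.IsMinimalResolution E →
      ZnModule.LengthAtMost E n) := by
  refine ⟨?_, fun E F hE hE' hF hF' => ZnModule.exists_iso_of_isMinimalResolution hE hE' hF hF',
    fun E hE hE' => ZnModule.lengthAtMost_of_isMinimalResolution hE.exists_indecSum hE'⟩
  tfae_have 1 → 3 := fun h => ⟨ZnModule.minimalResolution ⟨N, h⟩,
    ZnModule.isFiniteResolution_minimalResolution ⟨N, h⟩,
    ZnModule.isMinimalResolution_minimalResolution ⟨N, h⟩⟩
  tfae_have 3 → 2 := fun ⟨E, hE, _⟩ => ⟨E, hE⟩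
  tfae_have 2 → 1 := fun ⟨E, hE⟩ => ZnModule.finitelyDetermined_of_resolution hE.exists_indecSum
  tfae_finish
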